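/- Theorem 2.4. Let $Q$ be a finite-dimensional smooth ($C^\infty$, Hausdorff) manifold without boundary, with tangent bundle $\tau_Q : TQ \to Q$. Let $\Gamma$ be an (explicit) standard SODE on $Q$, that is, a smooth vector field on $TQ$ with $T\tau_Q(\Gamma(v)) = v$ for all $v \in TQ$. For an interval $J$, a trajectory of $\Gamma$ is a differentiable curve $\sigma : J \to Q$ whose tangent lift $\dot\sigma : J \to TQ$ is an integral curve of $\Gamma$ (one-sided derivatives at end points of $J$). Let $\Phi^\Gamma_t$ be the flow of $\Gamma$, let $D^\Gamma_t \subseteq TQ$ be the set of those $v$ for which the maximal integral curve of $\Gamma$ starting at $v$ is defined up to time $t$, and put $$\exp^\Gamma_h : D^\Gamma_h \to Q \times Q, \qquad \exp^\Gamma_h(v) = (\tau_Q(v), \tau_Q(\Phi^\Gamma_h(v))).$$ Let $q_0 \in Q$. Then there are $h_0 > 0$, compact sets $C \subseteq Q$ and $\bar C \subseteq TQ$ with $q_0 \in C$, and tangent vectors $v_{(h,q_0)} \in T_{q_0}Q$ for $0 < h \le h_0$, such that for every $h$ with $0 < h \le h_0$ the following holds. (0) $v_{(h,q_0)} \in \bar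 C$; there is a unique trajectory $\sigma : [0,h] \to C$ of $\Gamma$ with $\sigma(0) = \sigma(h) = q_0$ and $\dot\sigma(t) \in \bar C$ for all $t \in [0,h]$; and $\dot\sigma(0) = v_{(h,q_0)}$. Moreover, there are an open set $\mathcal U \subseteq TQ$ with $v_{(h,q_0)} \in \mathcal U \subseteq D^\Gamma_h$, and an open set $U \subseteq Q$ with $q_0 \in U$, such that: (i) $\exp^\Gamma_h$ restricts to a $C^\infty$ diffeomorphism from $\mathcal U$ onto $U \times U$. (ii) For every $(q,q') \in U \times U$ there is a unique trajectory $\sigma_{qq'h} : [0,h] \to Q$ of $\Gamma$ with $\sigma_{qq'h}(0) = q$, $\sigma_{qq'h}(h) = q'$ and $\dot\sigma_{qq'h}(0) \in \mathcal U$. (iii) $\Phi^\Gamma_h(\mathcal U)$ is open and contained in $D^\Gamma_{-h}$, and $\exp^\Gamma_h \circ \Phi^\Gamma_{-h}$ restricts to a $C^\infty$ diffeomorphism from $\Phi^\Gamma_h(\mathcal U)$ onto $U \times U$. The inverses $R^{e-}_h : U \times U \to \mathcal U$ and $R^{e+}_h : U \times U \to \Phi^\Gamma_h(\mathcal U)$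 of the diffeomorphisms in (i) and (iii) (the exact retraction maps of $\Gamma$) satisfy $R^{e+}_h = \Phi^\Gamma_h \circ R^{e-}_h$ and, for all $(q,q') \in U \times U$, $$R^{e-}_h(q,q') = \dot\sigma_{qq'h}(0), \qquad R^{e+}_h(q,q') = \dot\sigma_{qq'h}(h).$$ -/

import Mathlib

open Set
open scoped Manifold ContDiff

noncomputable section

namespace SODE

variable {E : Type*} [NormedAddCommGroup E] [NormedSpace ℝ E]
  {Q : Type*} [TopologicalSpace Q] [ChartedSpace E Q] [IsManifold 𝓘(ℝ, E) ∞ Q]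

variable (E Q) in
/-- The tangent bundle `TQ` of a manifold `Q` without boundary modelled on `E`. -/
abbrev TB : Type _ := TangentBundle 𝓘(ℝ, E) Q

variable (E Q) in
/-- A (rough) vector field on `TQ`: a choice of an element of `T_v (TQ)` for every `v ∈ TQ`. -/
abbrev VectorFieldOnTB : Type _ :=
  (v : TB E Q) → TangentSpace 𝓘(ℝ, E).tangent v

/-- An explicit second order differential equation: a smooth vector field `Γ` on `TQ` with
`Tτ_Q (Γ v) = v` for every `v ∈ TQ`; in natural coordinates
`Γ = q̇ⁱ ∂/∂qⁱ + ξⁱ(q, q̇) ∂/∂q̇ⁱ`. -/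
structure IsSODE (Γ : VectorFieldOnTB E Q) : Prop where
  smooth : ContMDiff 𝓘(ℝ, E).tangent 𝓘(ℝ, E).tangent.tangent ∞
    (fun v : TB E Q => (⟨v, Γ v⟩ : TangentBundle 𝓘(ℝ, E).tangent (TB E Q)))
  secondOrder : ∀ v : TB E Q,
    mfderiv 𝓘(ℝ, E).tangent 𝓘(ℝ, E) (fun w : TB E Q => w.proj) v (Γ v) = v.snd

/-- The velocity `σ̇(t) ∈ TQ` at time `t` of a curve `σ` defined on the interval `s`
(one-sided at an end point of `s`). The values of `σ` outside `s` are irrelevant. -/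
def velocity (σ : ℝ → Q) (s : Set ℝ) (t : ℝ) : TB E Q :=
  ⟨σ t, mfderivWithin 𝓘(ℝ, ℝ) 𝓘(ℝ, E) σ s t (1 : ℝ)⟩

/-- `σ : s → Q` is a trajectory of `Γ`: its tangent lift is an integral curve of `Γ`. -/
def IsTrajectoryOn (Γ : VectorFieldOnTB E Q) (σ : ℝ → Q) (s : Set ℝ) : Prop :=
  MDifferentiableOn 𝓘(ℝ, ℝ) 𝓘(ℝ, E) σ s ∧
    IsMIntegralCurveOn (I := 𝓘(ℝ, E).tangent) (velocity (E := E) σ s) Γ s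

/-- The open set `D_t^Γ` of those `v ∈ TQ` for which the maximal integral curve of `Γ` starting
at `v` is defined up to time `t` (`t` may be negative). -/
def flowDomain (Γ : VectorFieldOnTB E Q) (t : ℝ) : Set (TB E Q) :=
  {v | ∃ (γ : ℝ → TB E Q) (a b : ℝ), 0 ∈ Ioo a b ∧ t ∈ Ioo a b ∧ γ 0 = v ∧
    IsMIntegralCurveOn (I := 𝓘(ℝ, E).tangent) γ Γ (Ioo a b)}

open Classical in
/-- The flow `Φ_t^Γ`: the value at time `t` of the integral curve of `Γ` starting at `v`.
For a smooth `Γ` on a Hausdorff manifold this does not depend on the chosen integral curve.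
Outside `flowDomain Γ t` the value is irrelevant. -/
def flow (Γ : VectorFieldOnTB E Q) (t : ℝ) (v : TB E Q) : TB E Q :=
  if hv : v ∈ flowDomain Γ t then hv.choose t else v

/-- The exponential map `exp_h^Γ (v) = (τ_Q v, τ_Q (Φ_h^Γ v))`, meaningful on `flowDomain Γ h`. -/
def expMap (Γ : VectorFieldOnTB E Q) (h : ℝ) (v : TB E Q) : Q × Q :=
  (v.proj, (flow Γ h v).proj)

/-- `σ : [0, h] → C` is a trajectory of `Γ` from `q₀` to `q₀` with all its velocities in `K`. -/
structure IsLoopIn (Γ : VectorFieldOnTB E Q) (q₀ : Q) (h : ℝ) (C : Set Q) (K : Set (TB E Q))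
    (σ : ℝ → Q) : Prop where
  trajectory : IsTrajectoryOn Γ σ (Icc 0 h)
  start : σ 0 = q₀
  finish : σ h = q₀
  mem : ∀ t ∈ Icc 0 h, σ t ∈ C
  velocity_mem : ∀ t ∈ Icc 0 h, velocity (E := E) σ (Icc 0 h) t ∈ K

/-- `σ : [0, h] → Q` is a trajectory of `Γ` from `q` to `q'` with initial velocity in `𝒰`. -/
structure IsJoinIn (Γ : VectorFieldOnTB E Q) (h : ℝ) (𝒰 : Set (TB E Q)) (q q' : Q)
    (σ : ℝ → Q) : Prop where
  trajectory : IsTrajectoryOn Γ σ (Icc 0 h)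
  start : σ 0 = q
  finish : σ h = q'
  velocity_mem : velocity (E := E) σ (Icc 0 h) 0 ∈ 𝒰

/-- `f` restricts to a `C^∞` diffeomorphism from the open set `s` onto the open set `t`, with
inverse `g : t → s`. The values of `f` outside `s` and of `g` outside `t` are irrelevant. -/
structure IsDiffeoWithInverse {F H F' H' M N : Type*}
    [NormedAddCommGroup F] [NormedSpace ℝ F] [TopologicalSpace H] (I : ModelWithCorners ℝ F H)
    [NormedAddCommGroup F'] [NormedSpace ℝ F'] [TopologicalSpace H'] (J : ModelWithCorners ℝ F' H')
    [TopologicalSpace M] [ChartedSpace H M] [TopologicalSpace N] [ChartedSpace H' N]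
    (f : M → N) (g : N → M) (s : Set M) (t : Set N) : Prop where
  isOpen_source : IsOpen s
  isOpen_target : IsOpen t
  mapsTo : MapsTo f s t
  mapsTo_inverse : MapsTo g t s
  leftInvOn : LeftInvOn g f s
  rightInvOn : RightInvOn g f t
  smooth : ContMDiffOn I J ∞ f s
  smooth_inverse : ContMDiffOn J I ∞ g t

end SODE

end

/-!
Everything happens in one natural chart of `TQ` around the zero vector at `q₀`, where `Γ` becomes a
field `X(x, w) = (w, ξ(x, w))`. Rescaling time by `t = h s`, the integral curves of duration `h` are
the solutions of `c' = h X(c)` over `s ∈ [0, 1]`, and this equation makes sense for `h = 0` as well.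

*Smoothness of the flow.* The superposition operator `α ↦ X ∘ α` is smooth on the Banach space of
continuous curves (`contDiff_comp_left`). So is `(h, α) ↦ (h, α - h ∫ X ∘ α)`, whose derivative at
`h = 0` is the identity plus an operator of square zero; the inverse function theorem therefore
gives the solution `c` with initial value `z` as a smooth function of `(h, z)`
(`exists_smooth_rescaled_flow`).

*The boundary value problem.* The end point of the solution with initial data `(x, w)` is `x + h m`,
where `m` is the mean velocity over `[0, 1]`. The exponential map degenerates at `h = 0`, but
`(h, x, w) ↦ (h, x, m)` does not: it is the identity for `h = 0`, hence a local diffeomorphism `e`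
near `(0, x₀, 0)` (`exists_isLocalFlow`). Its injectivity and surjectivity near `(0, x₀, 0)` give
all the claims at once for all small `h > 0`. The loop at `q₀` corresponds to `m = 0`
(`IsLocalFlow.exists_loop`), and a pair `(q, q')` of points with coordinates `(x, x')` to
`m = (x' - x) / h`, so that `e.symm` yields the inverse of the exponential map
(`IsLocalFlow.exists_retraction`).

*Transfer to the manifold.* Integral curves on compact intervals are unique, one-sided derivatives
at the end points included (`eqOn_Icc_of_isMIntegralCurveOn`), and the trajectories of `Γ` are the
base curves of its integral curves (`IsSODE.isTrajectoryOn_proj`); this turns the statements about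
the local flow into statements about arbitrary trajectories.
-/

noncomputable section

namespace SODE

/-! ### Superposition operators on spaces of continuous maps -/

section Superposition
open Topology

variable {S : Type*} [TopologicalSpace S] [CompactSpace S]

/-- Pointwise application of a continuous family of operators to a continuous family of vectors,
as a bounded bilinear map. -/
def pointwiseApply (S : Type*) [TopologicalSpace S] [CompactSpace S]
    (F G : Type*) [NormedAddCommGroup F] [NormedSpace ℝ F]
    [NormedAddCommGroup G] [NormedSpace ℝ G] :
    C(S, F →L[ℝ] G) →L[ℝ] C(S, F) →L[ℝ] C(S, G) :=
  LinearMap.mkContinuous₂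
    (LinearMap.mk₂ ℝ (fun (A : C(S, F →L[ℝ] G)) (β : C(S, F)) =>
        (⟨fun s => A s (β s), by fun_prop⟩ : C(S, G)))
      (fun _ _ _ => by ext; simp) (fun _ _ _ => by ext; simp)
      (fun _ _ _ => by ext; simp) (fun _ _ _ => by ext; simp)) 1
    (fun A β => by
      refine (ContinuousMap.norm_le _ (by positivity)).2 fun s => ?_
      rw [one_mul]
      exact (ContinuousLinearMap.le_opNorm _ _).trans
        (mul_le_mul (A.norm_coe_le_norm s) (β.norm_coe_le_norm s) (norm_nonneg _) (by positivity)))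

/-- The remainder estimate is uniform because `fderiv ℝ X` is uniformly continuous near the compact
range of `α`. -/
theorem hasFDerivAt_comp_left {F G : Type*} [NormedAddCommGroup F] [NormedSpace ℝ F]
    [NormedAddCommGroup G] [NormedSpace ℝ G] {X : F → G} (hX : ContDiff ℝ 1 X) (α : C(S, F)) :
    HasFDerivAt (fun α : C(S, F) => (⟨X, hX.continuous⟩ : C(F, G)).comp α)
      (pointwiseApply S F G
        ((⟨fderiv ℝ X, hX.continuous_fderiv one_ne_zero⟩ : C(F, F →L[ℝ] G)).comp α)) α := by
  rw [hasFDerivAt_iff_isLittleO, Asymptotics.isLittleO_iff]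
  intro ε hε
  have hK : IsCompact (range α) := isCompact_range α.continuous
  have hu := hK.uniformContinuousAt_of_continuousAt (fderiv ℝ X)
    (fun a _ => (hX.continuous_fderiv one_ne_zero).continuousAt) (Metric.dist_mem_uniformity hε)
  obtain ⟨δ, hδ, hδ'⟩ := Metric.mem_uniformity_dist.1 hu
  filter_upwards [Metric.ball_mem_nhds α hδ] with β hβ
  refine (ContinuousMap.norm_le _ (by positivity)).2 fun s => ?_
  have hs : dist (β s) (α s) < δ := (ContinuousMap.dist_apply_le_dist s).trans_lt hβ
  have key := (convex_ball (α s) δ).norm_image_sub_le_of_norm_hasFDerivWithin_le'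
    (f := X) (f' := fderiv ℝ X) (φ := fderiv ℝ X (α s)) (C := ε) (x := α s) (y := β s)
    (fun y _ => (hX.differentiable one_ne_zero y).hasFDerivAt.hasFDerivWithinAt)
    (fun y hy => by
      have := hδ' (a := α s) (b := y) (by rw [dist_comm]; exact hy) ⟨s, rfl⟩
      rw [← dist_eq_norm, dist_comm]
      exact (le_of_lt this)) (Metric.mem_ball_self hδ) hs
  calc _ = ‖X (β s) - X (α s) - fderiv ℝ X (α s) (β s - α s)‖ := rfl
    _ ≤ ε * ‖β s - α s‖ := key
    _ ≤ ε * ‖β - α‖ := by gcongr; exact (β - α).norm_coe_le_norm s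

/-- The superposition operator `α ↦ X ∘ α` of a smooth map is smooth on spaces of continuous maps:
its derivative is the superposition operator of `fderiv ℝ X` followed by a bounded linear map, so
induction on the order of differentiability applies. -/
theorem contDiff_comp_left.{u} {F : Type u} [NormedAddCommGroup F] [NormedSpace ℝ F] (n : ℕ) :
    ∀ {G : Type u} [NormedAddCommGroup G] [NormedSpace ℝ G] {X : F → G} (hX : ContDiff ℝ ∞ X),
    ContDiff ℝ n (fun α : C(S, F) => (⟨X, hX.continuous⟩ : C(F, G)).comp α) := by
  induction n with
  | zero =>
    intro G _ _ X hX
    exact contDiff_zero.2 (ContinuousMap.continuous_postcomp _)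
  | succ n ih =>
    intro G _ _ X hX
    have h1 : ContDiff ℝ 1 X := hX.of_le (by exact_mod_cast le_top)
    have hD : ContDiff ℝ ∞ (fderiv ℝ X) := hX.fderiv_right (by exact_mod_cast le_top)
    rw [Nat.cast_succ, contDiff_succ_iff_hasFDerivAt]
    have hP : ContDiff ℝ n (pointwiseApply S F G) := ContinuousLinearMap.contDiff _
    exact ⟨fun α => pointwiseApply S F G ((⟨fderiv ℝ X, hD.continuous⟩ : C(F, F →L[ℝ] G)).comp α),
      hP.comp (ih hD), fun α => hasFDerivAt_comp_left h1 α⟩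

end Superposition

/-! ### Inverse function theorem at a unipotent derivative -/

section InverseFunction

variable {A : Type*} [NormedAddCommGroup A] [NormedSpace ℝ A]

/-- The isomorphism `1 + T` for an operator `T` with `T² = 0`. -/
def oneAddEquiv (T : A →L[ℝ] A) (hT : ∀ x, T (T x) = 0) : A ≃L[ℝ] A :=
  ContinuousLinearEquiv.equivOfInverse (1 + T) (1 - T)
    (fun x => by simp [hT]) (fun x => by simp [hT])

/-- Inverse function theorem for a smooth map with unipotent derivative at `a`, giving an inverse
that is smooth on its whole domain. -/
theorem exists_openPartialHomeomorph [CompleteSpace A] {f : A → A} {W : Set A} (hW : IsOpen W)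
    (hf : ContDiffOn ℝ ∞ f W) {a : A} (ha : a ∈ W) {T : A →L[ℝ] A} (hT : ∀ x, T (T x) = 0)
    (hfa : HasFDerivAt f (1 + T) a) :
    ∃ e : OpenPartialHomeomorph A A, a ∈ e.source ∧ e.source ⊆ W ∧ (∀ x, e x = f x) ∧
      ContDiffOn ℝ ∞ e.symm e.target := by
  have hfa' : HasFDerivAt f (oneAddEquiv T hT : A →L[ℝ] A) a := hfa
  have hca : ContDiffAt ℝ ∞ f a := hf.contDiffAt (hW.mem_nhds ha)
  let e₀ := hca.toOpenPartialHomeomorph f hfa' (by simp)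
  have he₀ : ∀ x, e₀ x = f x := fun x => rfl
  -- restrict to the points where the derivative is invertible, so that the inverse is smooth there
  let V : Set A := W ∩ fderiv ℝ f ⁻¹' range ContinuousLinearEquiv.toContinuousLinearMap
  have hV : IsOpen V :=
    (hf.continuousOn_fderiv_of_isOpen hW (by simp)).isOpen_inter_preimage hW
      ContinuousLinearEquiv.isOpen
  refine ⟨e₀.restrOpen V hV, ?_, ?_, fun x => he₀ x, ?_⟩
  · refine ⟨hca.mem_toOpenPartialHomeomorph_source hfa' (by simp), ha, ?_⟩
    exact ⟨oneAddEquiv T hT, hfa'.fderiv.symm⟩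
  · exact fun x hx => hx.2.1
  · intro y hy
    have hx : (e₀.restrOpen V hV).symm y ∈ (e₀.restrOpen V hV).source :=
      (e₀.restrOpen V hV).map_target hy
    obtain ⟨hxW, L, hL⟩ := hx.2
    refine ((e₀.restrOpen V hV).contDiffAt_symm (f₀' := L) hy ?_ ?_).contDiffWithinAt
    · have : HasFDerivAt f (fderiv ℝ f ((e₀.restrOpen V hV).symm y))
          ((e₀.restrOpen V hV).symm y) :=
        ((hf.contDiffAt (hW.mem_nhds hxW)).differentiableAt (by simp)).hasFDerivAt
      rw [← hL] at this
      exact this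
    · exact hf.contDiffAt (hW.mem_nhds hxW)

end InverseFunction

/-! ### Smooth dependence of solutions on initial values and time step -/

section LocalFlow
open Topology

variable {F : Type*} [NormedAddCommGroup F]

/-- The extension of a continuous curve on `[-2, 2]` to the real line, constant beyond the ends. -/
def extendCurve (α : C(Icc (-2 : ℝ) 2, F)) : ℝ → F :=
  IccExtend (by norm_num : (-2 : ℝ) ≤ 2) α

theorem continuous_extendCurve (α : C(Icc (-2 : ℝ) 2, F)) : Continuous (extendCurve α) :=
  α.continuous.Icc_extend'

theorem extendCurve_mem (α : C(Icc (-2 : ℝ) 2, F)) (s : Icc (-2 : ℝ) 2) :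
    extendCurve α s = α s := IccExtend_val _ _ _

theorem norm_extendCurve_le (α : C(Icc (-2 : ℝ) 2, F)) (s : ℝ) : ‖extendCurve α s‖ ≤ ‖α‖ :=
  α.norm_coe_le_norm _

variable [NormedSpace ℝ F]

/-- The primitive vanishing at `0`, as a bounded operator on curves over `[-2, 2]`. -/
def primitive (F : Type*) [NormedAddCommGroup F] [NormedSpace ℝ F] :
    C(Icc (-2 : ℝ) 2, F) →L[ℝ] C(Icc (-2 : ℝ) 2, F) :=
  LinearMap.mkContinuous
    { toFun := fun α => ⟨fun s => ∫ r in (0 : ℝ)..s, extendCurve α r,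
        (intervalIntegral.continuous_primitive
          (fun a b => (continuous_extendCurve α).intervalIntegrable a b) 0).comp
            continuous_subtype_val⟩
      map_add' := fun α β => by
        ext s
        exact intervalIntegral.integral_add ((continuous_extendCurve α).intervalIntegrable _ _)
          ((continuous_extendCurve β).intervalIntegrable _ _)
      map_smul' := fun c α => by
        ext s
        exact intervalIntegral.integral_smul c _ } 2
    (fun α => by
      refine (ContinuousMap.norm_le _ (by positivity)).2 fun s => ?_
      refine (intervalIntegral.norm_integral_le_of_norm_le_const (C := ‖α‖)
        (fun r _ => norm_extendCurve_le α r)).trans ?_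
      rw [mul_comm]
      gcongr
      rw [sub_zero]
      exact abs_le.2 s.2)

theorem primitive_apply (α : C(Icc (-2 : ℝ) 2, F)) (s : Icc (-2 : ℝ) 2) :
    primitive F α s = ∫ r in (0 : ℝ)..s, extendCurve α r := rfl

/-- Time-rescaled local flow of a smooth vector field `X`: for `(h, z)` near `(0, z₀)` there is a
curve `φ (h, z)` on `[-2, 2]` solving `c' = h X(c)`, `c 0 = z`, and it depends smoothly on `(h, z)`
as an element of the Banach space of continuous curves. It is obtained by inverting
`(h, α) ↦ (h, α - h ∫ X ∘ α)` near `(0, z₀)`, where the derivative is unipotent. -/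
theorem exists_smooth_rescaled_flow [CompleteSpace F] {X : F → F} (hX : ContDiff ℝ ∞ X) (z₀ : F) :
    ∃ (N : Set (ℝ × F)) (φ : ℝ × F → C(Icc (-2 : ℝ) 2, F)), IsOpen N ∧ (0, z₀) ∈ N ∧
      ContDiffOn ℝ ∞ φ N ∧
      ∀ p ∈ N, ∀ s ∈ Icc (-2 : ℝ) 2,
        extendCurve (φ p) s = p.2 + p.1 • ∫ r in (0 : ℝ)..s, X (extendCurve (φ p) r) := by
  let Y := C(Icc (-2 : ℝ) 2, F)
  let B : Y → Y := fun α => primitive F ((⟨X, hX.continuous⟩ : C(F, F)).comp α)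
  have hB : ContDiff ℝ ∞ B :=
    (primitive F).contDiff.comp (contDiff_infty.2 fun n => contDiff_comp_left n hX)
  let c₀ : Y := ContinuousMap.const _ z₀
  let f : ℝ × Y → ℝ × Y := fun p => (p.1, p.2 - p.1 • B p.2)
  have hf : ContDiff ℝ ∞ f :=
    contDiff_fst.prodMk (contDiff_snd.sub (contDiff_fst.smul (hB.comp contDiff_snd)))
  let T : ℝ × Y →L[ℝ] ℝ × Y :=
    (ContinuousLinearMap.inr ℝ ℝ Y).comp
      (-(ContinuousLinearMap.fst ℝ ℝ Y).smulRight (B c₀))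
  have hT : ∀ x, T (T x) = 0 := fun x => by simp [T]
  have hfa : HasFDerivAt f (1 + T) (0, c₀) := by
    have hB' : HasFDerivAt (fun p : ℝ × Y => B p.2) _ (0, c₀) :=
      ((hB.comp contDiff_snd).differentiable (by simp) (0, c₀)).hasFDerivAt
    have h1 : HasFDerivAt (fun p : ℝ × Y => p.1) (ContinuousLinearMap.fst ℝ ℝ Y) (0, c₀) :=
      hasFDerivAt_fst
    have h2 : HasFDerivAt (fun p : ℝ × Y => p.2) (ContinuousLinearMap.snd ℝ ℝ Y) (0, c₀) :=
      hasFDerivAt_snd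
    refine (h1.prodMk (h2.sub (h1.smul hB'))).congr_fderiv ?_
    ext x <;> simp [T, sub_eq_add_neg]
  obtain ⟨e, hae, -, hef, hes⟩ :=
    exists_openPartialHomeomorph isOpen_univ hf.contDiffOn (mem_univ _) hT hfa
  have hj : ContDiff ℝ ∞ (fun p : ℝ × F => ((p.1, ContinuousLinearMap.const ℝ _ p.2) : ℝ × Y)) :=
    contDiff_fst.prodMk
      ((ContinuousLinearMap.const ℝ (Icc (-2 : ℝ) 2) : F →L[ℝ] Y).contDiff.comp contDiff_snd)
  refine ⟨(fun p : ℝ × F => ((p.1, ContinuousLinearMap.const ℝ _ p.2) : ℝ × Y)) ⁻¹' e.target,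
    fun p => (e.symm (p.1, ContinuousLinearMap.const ℝ _ p.2)).2,
    e.open_target.preimage hj.continuous, ?_, ?_, ?_⟩
  · have := e.map_source hae
    rw [hef, show f (0, c₀) = (0, c₀) by simp [f]] at this
    exact this
  · exact (hes.comp hj.contDiffOn (fun p hp => hp)).snd
  · intro p hp s hs
    have h1 := e.right_inv hp
    rw [hef] at h1
    set q := e.symm (p.1, ContinuousLinearMap.const ℝ _ p.2)
    have h2 : q.1 = p.1 := congrArg Prod.fst h1
    have h3 : q.2 - q.1 • B q.2 = ContinuousLinearMap.const ℝ _ p.2 := congrArg Prod.snd h1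
    have h4 := congrArg (fun α : Y => α ⟨s, hs⟩) (sub_eq_iff_eq_add.1 h3)
    rw [show extendCurve q.2 s = q.2 ⟨s, hs⟩ from extendCurve_mem q.2 ⟨s, hs⟩]
    refine h4.trans ?_
    rw [h2]
    rfl

theorem hasDerivAt_of_integral_eq {X : F → F} [CompleteSpace F] (hX : Continuous X) {h : ℝ} {z : F}
    {α : C(Icc (-2 : ℝ) 2, F)}
    (hα : ∀ s ∈ Icc (-2 : ℝ) 2,
        extendCurve α s = z + h • ∫ r in (0 : ℝ)..s, X (extendCurve α r))
    {s : ℝ} (hs : s ∈ Ioo (-2 : ℝ) 2) :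
    HasDerivAt (extendCurve α) (h • X (extendCurve α s)) s := by
  have hc : Continuous fun r => X (extendCurve α r) := hX.comp (continuous_extendCurve α)
  have := ((intervalIntegral.integral_hasDerivAt_right (hc.intervalIntegrable 0 s)
    (hc.stronglyMeasurableAtFilter _ _) hc.continuousAt).const_smul h).const_add z
  refine this.congr_of_eventuallyEq ?_
  filter_upwards [Icc_mem_nhds hs.1 hs.2] with r hr using hα r hr

end LocalFlow

/-! ### The boundary value problem in coordinates -/

section LocalBoundaryValue
open Topology

variable {E : Type*} [NormedAddCommGroup E] [NormedSpace ℝ E]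

/-- A smooth family of solution curves of a second order vector field `X` near `(x₀, 0)`, in
coordinates. For `(h, z) ∈ N` the curve `c (h, z)` solves `c' = h X(c)` on `(-2, 2)` with
`c 0 = z`, so that `c (h, z) 1` is the value at `z` of the time `h` flow, and it stays in `Ω`.
The local diffeomorphism `e` near `(0, x₀, 0)` sends `(h, x, w)` to `(h, x, m)`, where `m` is the
mean velocity over `[0, 1]` of the solution with initial data `(x, w)`; unlike the end point
`x + h m`, it remains nondegenerate in `w` at `h = 0`. The interval `(-2, 2)` is chosen to contain
`[0, 1]` in its interior, as `flowDomain` asks for solutions beyond the end time. -/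
structure IsLocalFlow (X : E × E → E × E) (x₀ : E) (Ω : Set (E × E)) (N : Set (ℝ × E × E))
    (c : ℝ × E × E → ℝ → E × E) (e : OpenPartialHomeomorph (ℝ × E × E) (ℝ × E × E)) : Prop where
  isOpen : IsOpen N
  start : ∀ p ∈ N, c p 0 = p.2
  hasDerivAt : ∀ p ∈ N, ∀ s ∈ Ioo (-2 : ℝ) 2, HasDerivAt (c p) (p.1 • X (c p s)) s
  mem : ∀ p ∈ N, ∀ s, c p s ∈ Ω
  smooth_end : ContDiffOn ℝ ∞ (fun p => c p 1) N
  small : ∀ V ∈ 𝓝 (x₀, (0 : E)), ∀ᶠ p in 𝓝 ((0 : ℝ), x₀, (0 : E)), ∀ s, c p s ∈ V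
  base_mem : ((0 : ℝ), x₀, (0 : E)) ∈ e.source
  source_subset : e.source ⊆ N
  back_mem : ∀ p ∈ e.source, (-p.1, c p 1) ∈ N
  map_base : e (0, x₀, 0) = (0, x₀, 0)
  map_fst : ∀ p ∈ e.source, (e p).1 = p.1
  map_snd_fst : ∀ p ∈ e.source, (e p).2.1 = p.2.1
  end_fst : ∀ p ∈ e.source, (c p 1).1 = p.2.1 + p.1 • (e p).2.2
  smooth_symm : ContDiffOn ℝ ∞ e.symm e.target

/-- Existence of the smooth family near `(x₀, 0)`: at `h = 0` the solutions are constant, so the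
mean velocity is `w` and the derivative of `(h, x, w) ↦ (h, x, m)` is unipotent. -/
theorem exists_isLocalFlow [CompleteSpace E] {X : E × E → E × E} (hX : ContDiff ℝ ∞ X) (x₀ : E)
    {Ω : Set (E × E)} (hΩ : Ω ∈ 𝓝 (x₀, (0 : E))) (hX1 : ∀ z ∈ Ω, (X z).1 = z.2) :
    ∃ N c e, IsLocalFlow X x₀ Ω N c e := by
  obtain ⟨N₀, φ, hN₀, hmem₀, hφ, hint⟩ := exists_smooth_rescaled_flow hX (x₀, (0 : E))
  let z₀ : E × E := (x₀, 0)
  have hcont : ContinuousAt φ (0, z₀) := hφ.continuousOn.continuousAt (hN₀.mem_nhds hmem₀)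
  have hbase : ∀ z, (0, z) ∈ N₀ → ∀ s, extendCurve (φ (0, z)) s = z := by
    intro z hz s
    have := hint (0, z) hz _ (projIcc (-2 : ℝ) 2 (by norm_num) s).2
    rw [zero_smul, add_zero, extendCurve_mem] at this
    exact this
  have hsmall : ∀ V ∈ 𝓝 z₀, ∀ᶠ p in 𝓝 ((0 : ℝ), z₀), ∀ s, extendCurve (φ p) s ∈ V := by
    intro V hV
    obtain ⟨ε, hε, hεV⟩ := Metric.mem_nhds_iff.1 hV
    filter_upwards [hcont.preimage_mem_nhds (Metric.ball_mem_nhds _ hε)] with p hp s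
    refine hεV ?_
    have h1 : dist (extendCurve (φ p) s) (extendCurve (φ (0, z₀)) s) ≤ dist (φ p) (φ (0, z₀)) :=
      ContinuousMap.dist_apply_le_dist _
    rw [hbase z₀ hmem₀] at h1
    exact h1.trans_lt hp
  obtain ⟨N₁, hN₁, hN₁o, hmem₁⟩ := mem_nhds_iff.1 (hsmall Ω hΩ)
  let N := N₀ ∩ N₁
  have hN : IsOpen N := hN₀.inter hN₁o
  have hmemN : (0, z₀) ∈ N := ⟨hmem₀, hmem₁⟩
  let I1 : Icc (-2 : ℝ) 2 := ⟨1, by norm_num⟩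
  let ev : C(Icc (-2 : ℝ) 2, E × E) →L[ℝ] E × E := ContinuousMap.evalCLM ℝ I1
  have hend : ContDiffOn ℝ ∞ (fun p => extendCurve (φ p) 1) N := by
    have h1 : ContDiffOn ℝ ∞ (fun p => ev (φ p)) N :=
      ev.contDiff.comp_contDiffOn (hφ.mono inter_subset_left)
    exact h1.congr fun p _ => extendCurve_mem (φ p) I1
  -- the mean velocity over the rescaled time interval `[0, 1]`
  let P : ℝ × E × E → E := fun p => (primitive (E × E) (φ p) I1).2
  have hP : ContDiffOn ℝ ∞ P N :=
    (ev.contDiff.comp_contDiffOn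
      ((primitive (E × E)).contDiff.comp_contDiffOn (hφ.mono inter_subset_left))).snd
  have hP0 : ∀ z, (0, z) ∈ N → P (0, z) = z.2 := by
    intro z hz
    simp only [P, primitive_apply, hbase z hz.1]
    simp [I1]
  have hPend : ∀ p ∈ N, (extendCurve (φ p) 1).1 = p.2.1 + p.1 • P p := by
    intro p hp
    have h1 := congrArg Prod.fst (hint p hp.1 1 I1.2)
    rw [h1]
    have hc := continuous_extendCurve (φ p)
    have e1 : (∫ r in (0 : ℝ)..1, X (extendCurve (φ p) r)).1 =
        ∫ r in (0 : ℝ)..1, (X (extendCurve (φ p) r)).1 :=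
      ((ContinuousLinearMap.fst ℝ E E).intervalIntegral_comp_comm
        ((hX.continuous.comp hc).intervalIntegrable 0 1)).symm
    have e2 : (∫ r in (0 : ℝ)..1, extendCurve (φ p) r).2 =
        ∫ r in (0 : ℝ)..1, (extendCurve (φ p) r).2 :=
      ((ContinuousLinearMap.snd ℝ E E).intervalIntegral_comp_comm
        (hc.intervalIntegrable 0 1)).symm
    simp only [P, primitive_apply, I1, Prod.fst_add, Prod.smul_fst, e1, e2]
    congr 2
    exact intervalIntegral.integral_congr fun r _ => hX1 _ (hN₁ hp.2 r)
  let f : ℝ × E × E → ℝ × E × E := fun p => (p.1, p.2.1, P p)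
  have hf : ContDiffOn ℝ ∞ f N :=
    contDiffOn_fst.prodMk (contDiffOn_snd.fst.prodMk hP)
  let D := fderiv ℝ P (0, z₀)
  have hPd : HasFDerivAt P D (0, z₀) :=
    ((hP.contDiffAt (hN.mem_nhds hmemN)).differentiableAt (by simp)).hasFDerivAt
  have hD : ∀ z : E × E, D (0, z) = z.2 := by
    have h1 : HasFDerivAt (fun z : E × E => P (0, z)) (D.comp (ContinuousLinearMap.inr ℝ ℝ _)) z₀ :=
      HasFDerivAt.comp (f := fun z : E × E => ((0 : ℝ), z)) z₀ hPd (hasFDerivAt_prodMk_right 0 z₀)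
    have h2 : HasFDerivAt (fun z : E × E => P (0, z)) (ContinuousLinearMap.snd ℝ E E) z₀ := by
      refine hasFDerivAt_snd.congr_of_eventuallyEq ?_
      have : ∀ᶠ z in 𝓝 z₀, ((0 : ℝ), z) ∈ N :=
        (Continuous.prodMk_right (0 : ℝ)).continuousAt.preimage_mem_nhds (hN.mem_nhds hmemN)
      filter_upwards [this] with z hz using hP0 z hz
    intro z
    exact DFunLike.congr_fun (h1.unique h2) z
  let T : ℝ × E × E →L[ℝ] ℝ × E × E :=
    (ContinuousLinearMap.inr ℝ ℝ (E × E)).comp ((ContinuousLinearMap.inr ℝ E E).comp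
      ((ContinuousLinearMap.fst ℝ ℝ (E × E)).smulRight (D (1, 0))))
  have hT : ∀ x, T (T x) = 0 := fun x => by simp [T]
  have hfa : HasFDerivAt f (1 + T) (0, z₀) := by
    refine (hasFDerivAt_fst.prodMk (hasFDerivAt_snd.fst.prodMk hPd)).congr_fderiv ?_
    refine ContinuousLinearMap.ext fun x => ?_
    obtain ⟨t, z⟩ := x
    have h3 : D (t, z) = z.2 + t • D (1, 0) := by
      rw [← hD z, ← D.map_smul, ← D.map_add]
      simp
    refine Prod.ext ?_ (Prod.ext ?_ ?_)
    · simp [T]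
    · simp [T]
    · simpa [T] using h3
  -- restrict to initial data whose end point can be flowed back
  let W : Set (ℝ × E × E) := N ∩ (fun p => (-p.1, extendCurve (φ p) 1)) ⁻¹' N
  have hW : IsOpen W :=
    (continuous_fst.neg.continuousOn.prodMk hend.continuousOn).isOpen_inter_preimage hN hN
  have hmemW : (0, z₀) ∈ W := by
    refine ⟨hmemN, ?_⟩
    change (-(0 : ℝ), extendCurve (φ (0, z₀)) 1) ∈ N
    rw [hbase z₀ hmem₀, neg_zero]
    exact hmemN
  obtain ⟨e, hae, heW, hef, hes⟩ :=
    exists_openPartialHomeomorph hW (hf.mono inter_subset_left) hmemW hT hfa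
  refine ⟨N, fun p => extendCurve (φ p), e, hN, ?_, ?_, ?_, hend, hsmall, hae,
    fun p hp => (heW hp).1, fun p hp => (heW hp).2, ?_, fun p _ => by rw [hef],
    fun p _ => by rw [hef], ?_, hes⟩
  · intro p hp
    simpa using hint p hp.1 0 (by norm_num)
  · exact fun p hp s hs => hasDerivAt_of_integral_eq hX.continuous (hint p hp.1) hs
  · exact fun p hp s => hN₁ hp.2 s
  · rw [hef]
    exact Prod.ext rfl (Prod.ext rfl (hP0 z₀ hmemN))
  · intro p hp
    rw [hef]
    exact hPend p (heW hp).1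

end LocalBoundaryValue

/-! ### Vector fields and integral curves in a chart -/

section ChartField
open Topology

variable {F : Type*} [NormedAddCommGroup F] [NormedSpace ℝ F] {H : Type*} [TopologicalSpace H]
  {I : ModelWithCorners ℝ F H} {M : Type*} [TopologicalSpace M] [ChartedSpace H M]

/-- The vector field `V` read in the preferred chart at `p`; meaningful on the chart target. -/
def chartField (V : (x : M) → TangentSpace I x) (p : M) (z : F) : F :=
  mfderiv I 𝓘(ℝ, F) (extChartAt I p) ((extChartAt I p).symm z) (V ((extChartAt I p).symm z))

theorem trivializationAt_snd_eq_mfderiv [IsManifold I 1 M] {p x : M}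
    (hx : x ∈ (chartAt H p).source) (v : TangentSpace I x) :
    (trivializationAt F (TangentSpace I) p ⟨x, v⟩).2 = mfderiv I 𝓘(ℝ, F) (extChartAt I p) x v := by
  have h1 : (trivializationAt F (TangentSpace I) p).continuousLinearMapAt ℝ x v =
      (trivializationAt F (TangentSpace I) p ⟨x, v⟩).2 := by
    rw [Bundle.Trivialization.continuousLinearMapAt_apply, Bundle.Trivialization.linearMapAt_apply]
    exact if_pos hx
  exact h1.symm.trans
    (DFunLike.congr_fun (TangentBundle.continuousLinearMapAt_trivializationAt (I := I) hx) v)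

theorem contDiffOn_chartField [IsManifold I ∞ M] [I.Boundaryless] {V : (x : M) → TangentSpace I x}
    (hV : ContMDiff I I.tangent ∞ (fun x => (⟨x, V x⟩ : TangentBundle I M))) (p : M) :
    ContDiffOn ℝ ∞ (chartField V p) (extChartAt I p).target := by
  have : IsManifold I 1 M := .of_le (n := ∞) (by exact_mod_cast le_top)
  have h1 := ((trivializationAt F (TangentSpace I) p).contMDiffOn_section_baseSet_iff
    (n := ∞) (IB := I) (s := V)).1 hV.contMDiffOn
  have h2 := (h1.comp (contMDiffOn_extChartAt_symm (n := ∞) (I := I) p)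
    (fun z hz => by simpa using (extChartAt I p).map_target hz)).contDiffOn
  refine h2.congr fun z hz => ?_
  exact (trivializationAt_snd_eq_mfderiv (by simpa using (extChartAt I p).map_target hz) _).symm

theorem hasDerivWithinAt_chart [IsManifold I 1 M] {V : (x : M) → TangentSpace I x} {γ : ℝ → M}
    {s : Set ℝ} {t : ℝ} (p : M)
    (hγ : HasMFDerivWithinAt 𝓘(ℝ, ℝ) I γ s t ((1 : ℝ →L[ℝ] ℝ).smulRight (V (γ t))))
    (hsrc : γ t ∈ (extChartAt I p).source) :
    HasDerivWithinAt (extChartAt I p ∘ γ) (chartField V p (extChartAt I p (γ t))) s t := by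
  have hsrc' : γ t ∈ (chartAt H p).source := by simpa using hsrc
  have h1 := ((mdifferentiableAt_extChartAt (I := I) hsrc').hasMFDerivAt).comp_hasMFDerivWithinAt t
    hγ
  rw [hasDerivWithinAt_iff_hasFDerivWithinAt]
  refine HasMFDerivWithinAt.hasFDerivWithinAt ?_
  refine h1.congr_mfderiv ?_
  refine ContinuousLinearMap.ext fun (a : ℝ) => ?_
  have h2 : chartField V p (extChartAt I p (γ t)) =
      mfderiv I 𝓘(ℝ, F) (extChartAt I p) (γ t) (V (γ t)) := by
    simp only [chartField]
    rw [(extChartAt I p).left_inv hsrc]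
  rw [h2]
  exact (mfderiv I 𝓘(ℝ, F) (extChartAt I p) (γ t)).map_smul a (V (γ t))

theorem hasMFDerivWithinAt_of_chart [IsManifold I 1 M] [I.Boundaryless]
    {V : (x : M) → TangentSpace I x} {z : ℝ → F}
    {s : Set ℝ} {t : ℝ} (p : M) (hz : HasDerivWithinAt z (chartField V p (z t)) s t)
    (htgt : z t ∈ (extChartAt I p).target) :
    HasMFDerivWithinAt 𝓘(ℝ, ℝ) I ((extChartAt I p).symm ∘ z) s t
      ((1 : ℝ →L[ℝ] ℝ).smulRight (V ((extChartAt I p).symm (z t)))) := by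
  have h1 := (mdifferentiableWithinAt_extChartAt_symm (I := I) htgt).hasMFDerivWithinAt.comp t
    hz.hasFDerivWithinAt.hasMFDerivWithinAt
    (fun r _ => by rw [I.range_eq_univ]; trivial)
  refine h1.congr_mfderiv ?_
  refine ContinuousLinearMap.ext fun (a : ℝ) => ?_
  have h2 := DFunLike.congr_fun (mfderivWithin_extChartAt_symm_comp_mfderiv_extChartAt htgt)
    (V ((extChartAt I p).symm (z t)))
  refine ((mfderivWithin 𝓘(ℝ, F) I (extChartAt I p).symm (range I) (z t)).map_smul a
    (chartField (F := F) V p (z t))).trans ?_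
  exact congrArg (fun u : TangentSpace I ((extChartAt I p).symm (z t)) => a • u) h2

/-- Uniqueness of integral curves on a compact interval, with one-sided derivatives at its ends. -/
theorem eqOn_Icc_of_isMIntegralCurveOn [IsManifold I ∞ M] [T2Space M] [I.Boundaryless]
    {V : (x : M) → TangentSpace I x}
    (hV : ContMDiff I I.tangent ∞ (fun x => (⟨x, V x⟩ : TangentBundle I M))) {γ γ' : ℝ → M}
    {a b : ℝ} (hγ : IsMIntegralCurveOn γ V (Icc a b)) (hγ' : IsMIntegralCurveOn γ' V (Icc a b))
    (h : γ a = γ' a) : EqOn γ γ' (Icc a b) := by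
  have : IsManifold I 1 M := .of_le (n := ∞) (by exact_mod_cast le_top)
  have hc := hγ.continuousOn
  have hc' := hγ'.continuousOn
  refine IsClosed.Icc_subset_of_forall_exists_gt (s := {t | γ t = γ' t}) ?_ h ?_
  · have : IsClosed (Icc a b ∩ (fun t => (γ t, γ' t)) ⁻¹' diagonal M) :=
      (hc.prodMk hc').preimage_isClosed_of_isClosed isClosed_Icc isClosed_diagonal
    rwa [inter_comm] at this
  · rintro t ⟨ht, hta⟩ y hy
    let e := extChartAt I (γ t)
    have htb : t ∈ Icc a b := Ico_subset_Icc_self hta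
    have hX : ContDiffAt ℝ 1 (chartField V (γ t)) (e (γ t)) :=
      ((contDiffOn_chartField hV (γ t)).contDiffAt
        (extChartAt_target_mem_nhds (I := I) (γ t))).of_le (by exact_mod_cast le_top)
    obtain ⟨L, W, hW, hL⟩ := hX.exists_lipschitzOnWith
    have hmem : ∀ β : ℝ → M, ContinuousOn β (Icc a b) → β t = γ t →
        ∀ᶠ r in 𝓝[Icc a b] t, β r ∈ e.source ∧ e (β r) ∈ W := by
      intro β hβ hβt
      have hβ' : Filter.Tendsto β (𝓝[Icc a b] t) (𝓝 (γ t)) := hβt ▸ hβ t htb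
      exact (hβ'.eventually (extChartAt_source_mem_nhds (I := I) (γ t))).and
        (hβ'.eventually ((continuousAt_extChartAt (I := I) (γ t)).preimage_mem_nhds hW))
    have hev := (hmem γ hc rfl).and (hmem γ' hc' (Eq.symm ht))
    have hle : 𝓝[≥] t ≤ 𝓝[Icc a b] t := by
      rw [← nhdsWithin_Icc_eq_nhdsGE hta.2]
      exact nhdsWithin_mono _ (Icc_subset_Icc_left hta.1)
    obtain ⟨u, hu, hus⟩ := mem_nhdsGE_iff_exists_Icc_subset.1 (hle hev)
    -- on `[t, d]` both curves stay where the coordinate field is Lipschitz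
    let d := min u (min y b)
    have htd : t < d := lt_min hu (lt_min hy hta.2)
    have hdb : d ≤ b := (min_le_right _ _).trans (min_le_right _ _)
    have hsub : Icc t d ⊆ Icc a b := Icc_subset_Icc hta.1 hdb
    have hin : ∀ r ∈ Icc t d, (γ r ∈ e.source ∧ e (γ r) ∈ W) ∧ (γ' r ∈ e.source ∧ e (γ' r) ∈ W) :=
      fun r hr => hus ⟨hr.1, hr.2.trans (min_le_left _ _)⟩
    have hode : ∀ β : ℝ → M, IsMIntegralCurveOn β V (Icc a b) → (∀ r ∈ Icc t d, β r ∈ e.source) →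
        ContinuousOn (e ∘ β) (Icc t d) ∧
        ∀ r ∈ Ico t d, HasDerivWithinAt (e ∘ β) (chartField V (γ t) ((e ∘ β) r)) (Ici r) r := by
      intro β hβ hs
      refine ⟨fun r hr => ?_, fun r hr => ?_⟩
      · exact ((hasDerivWithinAt_chart (γ t) (hβ r (hsub hr)) (hs r hr)).mono
          hsub).continuousWithinAt
      · have hr' := Ico_subset_Icc_self hr
        refine (hasDerivWithinAt_chart (γ t) (hβ r (hsub hr')) (hs r hr')).mono_of_mem_nhdsWithin ?_
        exact Filter.mem_of_superset (Icc_mem_nhdsGE (hr.2.trans_le hdb))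
          (Icc_subset_Icc_left (hta.1.trans hr.1))
    obtain ⟨c1, d1⟩ := hode γ hγ fun r hr => (hin r hr).1.1
    obtain ⟨c2, d2⟩ := hode γ' hγ' fun r hr => (hin r hr).2.1
    have key := ODE_solution_unique_of_mem_Icc_right (v := fun _ => chartField V (γ t))
      (s := fun _ => W) (K := L) (fun _ _ => hL) c1 d1
      (fun r hr => (hin r (Ico_subset_Icc_self hr)).1.2) c2 d2
      (fun r hr => (hin r (Ico_subset_Icc_self hr)).2.2) (congrArg e ht)
    have hd : d ∈ Icc t d := ⟨htd.le, le_rfl⟩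
    exact ⟨d, e.injOn (hin d hd).1.1 (hin d hd).2.1 (key hd), htd,
      (min_le_right _ _).trans (min_le_left _ _)⟩

end ChartField

/-! ### Natural charts of the tangent bundle and second order fields -/

section TangentBundle
open Topology

variable {E : Type*} [NormedAddCommGroup E] [NormedSpace ℝ E]
  {Q : Type*} [TopologicalSpace Q] [ChartedSpace E Q] [IsManifold 𝓘(ℝ, E) ∞ Q]

/-- The tangent bundle of a Hausdorff manifold is Hausdorff: vectors over distinct points are
separated by the projection, vectors over the same point by a trivialization. -/
theorem t2Space_TB [T2Space Q] : T2Space (TB E Q) := by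
  refine ⟨fun x y hxy => ?_⟩
  by_cases h : x.proj = y.proj
  · let e := trivializationAt E (TangentSpace 𝓘(ℝ, E)) x.proj
    have hx : x ∈ e.source := FiberBundle.mem_trivializationAt_proj_source
    have hy : y ∈ e.source := by rw [e.mem_source, ← h]; exact e.mem_source.1 hx
    obtain ⟨u, v, hu, hv, hxu, hyv, huv⟩ := t2_separation (e.injOn.ne hx hy hxy)
    exact ⟨e.source ∩ e ⁻¹' u, e.source ∩ e ⁻¹' v,
      e.continuousOn_toFun.isOpen_inter_preimage e.open_source hu,
      e.continuousOn_toFun.isOpen_inter_preimage e.open_source hv, ⟨hx, hxu⟩, ⟨hy, hyv⟩,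
      (huv.preimage e).mono inter_subset_right inter_subset_right⟩
  · obtain ⟨u, v, hu, hv, hxu, hyv, huv⟩ := t2_separation h
    have hc : Continuous (Bundle.TotalSpace.proj : TB E Q → Q) :=
      FiberBundle.continuous_proj E (TangentSpace 𝓘(ℝ, E))
    exact ⟨_, _, hu.preimage hc, hv.preimage hc, hxu, hyv, huv.preimage _⟩

theorem extChartAt_TB_source (p : TB E Q) :
    (extChartAt 𝓘(ℝ, E).tangent p).source =
      Bundle.TotalSpace.proj ⁻¹' (extChartAt 𝓘(ℝ, E) p.proj).source := by
  ext v
  simp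

theorem extChartAt_TB_fst (p v : TB E Q) :
    (extChartAt 𝓘(ℝ, E).tangent p v).1 = extChartAt 𝓘(ℝ, E) p.proj v.proj := rfl

theorem extChartAt_TB_snd {p v : TB E Q} (h : v.proj ∈ (extChartAt 𝓘(ℝ, E) p.proj).source) :
    (extChartAt 𝓘(ℝ, E).tangent p v).2 =
      mfderiv 𝓘(ℝ, E) 𝓘(ℝ, E) (extChartAt 𝓘(ℝ, E) p.proj) v.proj v.snd := by
  have : IsManifold 𝓘(ℝ, E) 1 Q := .of_le (n := ∞) (by exact_mod_cast le_top)
  exact trivializationAt_snd_eq_mfderiv (by simpa using h) v.snd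

theorem extChartAt_TB_self (q : Q) (w : TangentSpace 𝓘(ℝ, E) q) :
    extChartAt 𝓘(ℝ, E).tangent (⟨q, 0⟩ : TB E Q) ⟨q, w⟩ = (extChartAt 𝓘(ℝ, E) q q, w) :=
  Prod.ext rfl
    ((tangentBundleCore 𝓘(ℝ, E) Q).coordChange_self (achart _ q) q (mem_achart_source _ q) w)

theorem extChartAt_TB_symm_proj (p : TB E Q) {z : E × E}
    (hz : z ∈ (extChartAt 𝓘(ℝ, E).tangent p).target) :
    ((extChartAt 𝓘(ℝ, E).tangent p).symm z).proj = (extChartAt 𝓘(ℝ, E) p.proj).symm z.1 ∧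
      z.1 ∈ (extChartAt 𝓘(ℝ, E) p.proj).target := by
  have hs := (extChartAt 𝓘(ℝ, E).tangent p).map_target hz
  rw [extChartAt_TB_source] at hs
  have h1 : extChartAt 𝓘(ℝ, E) p.proj ((extChartAt 𝓘(ℝ, E).tangent p).symm z).proj = z.1 := by
    rw [← extChartAt_TB_fst, (extChartAt 𝓘(ℝ, E).tangent p).right_inv hz]
  exact ⟨by rw [← h1, (extChartAt 𝓘(ℝ, E) p.proj).left_inv hs],
    h1 ▸ (extChartAt 𝓘(ℝ, E) p.proj).map_source hs⟩

variable {Γ : VectorFieldOnTB E Q}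

/-- In natural coordinates a second order vector field has the form `(x, v) ↦ (v, ξ(x, v))`. -/
theorem IsSODE.chartField_fst (hΓ : IsSODE Γ) (p : TB E Q) {z : E × E}
    (hz : z ∈ (extChartAt 𝓘(ℝ, E).tangent p).target) :
    (chartField (I := 𝓘(ℝ, E).tangent) Γ p z).1 = z.2 := by
  have i1 : IsManifold 𝓘(ℝ, E) 1 Q := .of_le (n := ∞) (by exact_mod_cast le_top)
  have i2 : IsManifold 𝓘(ℝ, E).tangent 1 (TB E Q) := .of_le (n := ∞) (by exact_mod_cast le_top)
  set v : TB E Q := (extChartAt 𝓘(ℝ, E).tangent p).symm z with hv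
  have hs : v ∈ (extChartAt 𝓘(ℝ, E).tangent p).source :=
    (extChartAt 𝓘(ℝ, E).tangent p).map_target hz
  have hs' : v.proj ∈ (extChartAt 𝓘(ℝ, E) p.proj).source := by
    rw [extChartAt_TB_source] at hs; exact hs
  have hd1 : HasMFDerivAt 𝓘(ℝ, E).tangent 𝓘(ℝ, E × E) (extChartAt 𝓘(ℝ, E).tangent p) v
      (mfderiv 𝓘(ℝ, E).tangent 𝓘(ℝ, E × E) (extChartAt 𝓘(ℝ, E).tangent p) v) :=
    (mdifferentiableAt_extChartAt (by simpa using hs)).hasMFDerivAt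
  have hd2 : HasMFDerivAt 𝓘(ℝ, E × E) 𝓘(ℝ, E) (Prod.fst : E × E → E)
      (extChartAt 𝓘(ℝ, E).tangent p v) (ContinuousLinearMap.fst ℝ E E) :=
    (ContinuousLinearMap.fst ℝ E E).hasMFDerivAt
  have hd3 : HasMFDerivAt 𝓘(ℝ, E).tangent 𝓘(ℝ, E) (fun w : TB E Q => w.proj) v
      (mfderiv 𝓘(ℝ, E).tangent 𝓘(ℝ, E) (fun w : TB E Q => w.proj) v) :=
    ((Bundle.contMDiff_proj (n := 1) (IB := 𝓘(ℝ, E)) (TangentSpace 𝓘(ℝ, E) (M := Q))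
      v).mdifferentiableAt one_ne_zero).hasMFDerivAt
  have hd4 : HasMFDerivAt 𝓘(ℝ, E) 𝓘(ℝ, E) (extChartAt 𝓘(ℝ, E) p.proj) v.proj
      (mfderiv 𝓘(ℝ, E) 𝓘(ℝ, E) (extChartAt 𝓘(ℝ, E) p.proj) v.proj) :=
    (mdifferentiableAt_extChartAt (by simpa using hs')).hasMFDerivAt
  have h1 := hd2.comp v hd1
  have h2 := hd4.comp v hd3
  have h3 := DFunLike.congr_fun (hasMFDerivAt_unique h1 h2) (Γ v)
  have h4 : mfderiv 𝓘(ℝ, E) 𝓘(ℝ, E) (extChartAt 𝓘(ℝ, E) p.proj) v.proj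
      (mfderiv 𝓘(ℝ, E).tangent 𝓘(ℝ, E) (fun w : TB E Q => w.proj) v (Γ v)) =
      mfderiv 𝓘(ℝ, E) 𝓘(ℝ, E) (extChartAt 𝓘(ℝ, E) p.proj) v.proj v.snd :=
    congrArg _ (hΓ.secondOrder v)
  have h5 : (extChartAt 𝓘(ℝ, E).tangent p v).2 = z.2 := by
    rw [hv, (extChartAt 𝓘(ℝ, E).tangent p).right_inv hz]
  exact (Eq.trans h3 h4).trans ((extChartAt_TB_snd hs').symm.trans h5)

theorem IsSODE.hasMFDerivWithinAt_proj (hΓ : IsSODE Γ) {γ : ℝ → TB E Q} {s : Set ℝ} {t : ℝ}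
    (hγ : HasMFDerivWithinAt 𝓘(ℝ, ℝ) 𝓘(ℝ, E).tangent γ s t
      ((1 : ℝ →L[ℝ] ℝ).smulRight (Γ (γ t)))) :
    HasMFDerivWithinAt 𝓘(ℝ, ℝ) 𝓘(ℝ, E) (fun r => (γ r).proj) s t
      ((1 : ℝ →L[ℝ] ℝ).smulRight (γ t).snd) := by
  have i1 : IsManifold 𝓘(ℝ, E) 1 Q := .of_le (n := ∞) (by exact_mod_cast le_top)
  have hd3 : HasMFDerivAt 𝓘(ℝ, E).tangent 𝓘(ℝ, E) (fun w : TB E Q => w.proj) (γ t)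
      (mfderiv 𝓘(ℝ, E).tangent 𝓘(ℝ, E) (fun w : TB E Q => w.proj) (γ t)) :=
    ((Bundle.contMDiff_proj (n := 1) (IB := 𝓘(ℝ, E)) (TangentSpace 𝓘(ℝ, E) (M := Q))
      (γ t)).mdifferentiableAt one_ne_zero).hasMFDerivAt
  refine (hd3.comp_hasMFDerivWithinAt t hγ).congr_mfderiv ?_
  refine ContinuousLinearMap.ext fun (a : ℝ) => ?_
  refine ((mfderiv 𝓘(ℝ, E).tangent 𝓘(ℝ, E) (fun w : TB E Q => w.proj) (γ t)).map_smul a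
    (Γ (γ t))).trans ?_
  exact congrArg (fun u : TangentSpace 𝓘(ℝ, E) (γ t).proj => a • u) (hΓ.secondOrder (γ t))

/-- The tangent lift of the base curve of an integral curve is the integral curve itself. -/
theorem IsSODE.velocity_proj (hΓ : IsSODE Γ) {γ : ℝ → TB E Q} {s : Set ℝ} {t : ℝ}
    (hs : UniqueDiffWithinAt ℝ s t)
    (hγ : HasMFDerivWithinAt 𝓘(ℝ, ℝ) 𝓘(ℝ, E).tangent γ s t
      ((1 : ℝ →L[ℝ] ℝ).smulRight (Γ (γ t)))) :
    velocity (E := E) (fun r => (γ r).proj) s t = γ t := by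
  have h1 := (hΓ.hasMFDerivWithinAt_proj hγ).mfderivWithin hs.uniqueMDiffWithinAt
  have h2 : mfderivWithin 𝓘(ℝ, ℝ) 𝓘(ℝ, E) (fun r => (γ r).proj) s t (1 : ℝ) = (γ t).snd := by
    rw [h1]
    exact one_smul ℝ (γ t).snd
  unfold velocity
  rw [h2]

theorem IsSODE.isTrajectoryOn_proj (hΓ : IsSODE Γ) {γ : ℝ → TB E Q} {s : Set ℝ}
    (hs : UniqueDiffOn ℝ s) (hγ : IsMIntegralCurveOn (I := 𝓘(ℝ, E).tangent) γ Γ s) :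
    IsTrajectoryOn Γ (fun r => (γ r).proj) s := by
  have hv : ∀ t ∈ s, velocity (E := E) (fun r => (γ r).proj) s t = γ t :=
    fun t ht => hΓ.velocity_proj (hs t ht) (hγ t ht)
  refine ⟨fun t ht => (hΓ.hasMFDerivWithinAt_proj (hγ t ht)).mdifferentiableWithinAt, fun t ht => ?_⟩
  have h := hγ t ht
  rw [← hv t ht] at h
  exact h.congr_of_eventuallyEq (Filter.eventuallyEq_of_mem self_mem_nhdsWithin hv) (hv t ht)

end TangentBundle

/-! ### The flow of a second order field -/

section Flow
open Topology

variable {E : Type*} [NormedAddCommGroup E] [NormedSpace ℝ E]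
  {Q : Type*} [TopologicalSpace Q] [ChartedSpace E Q] [IsManifold 𝓘(ℝ, E) ∞ Q] [T2Space Q]
  {Γ : VectorFieldOnTB E Q}

theorem IsSODE.eqOn_Ioo (hΓ : IsSODE Γ) {γ γ' : ℝ → TB E Q} {a b t₀ : ℝ} (ht₀ : t₀ ∈ Ioo a b)
    (hγ : IsMIntegralCurveOn (I := 𝓘(ℝ, E).tangent) γ Γ (Ioo a b))
    (hγ' : IsMIntegralCurveOn (I := 𝓘(ℝ, E).tangent) γ' Γ (Ioo a b)) (h : γ t₀ = γ' t₀) :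
    EqOn γ γ' (Ioo a b) := by
  have : T2Space (TB E Q) := t2Space_TB
  have : IsManifold 𝓘(ℝ, E).tangent 1 (TB E Q) := .of_le (n := ∞) (by exact_mod_cast le_top)
  exact isMIntegralCurveOn_Ioo_eqOn_of_contMDiff_boundaryless ht₀
    (hΓ.smooth.of_le (by exact_mod_cast le_top)) hγ hγ' h

/-- The flow can be computed with any integral curve. -/
theorem IsSODE.flow_eq (hΓ : IsSODE Γ) {γ : ℝ → TB E Q} {a b t : ℝ} (h0 : 0 ∈ Ioo a b)
    (ht : t ∈ Ioo a b) (hγ : IsMIntegralCurveOn (I := 𝓘(ℝ, E).tangent) γ Γ (Ioo a b)) :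
    γ 0 ∈ flowDomain Γ t ∧ flow Γ t (γ 0) = γ t := by
  have hmem : γ 0 ∈ flowDomain Γ t := ⟨γ, a, b, h0, ht, rfl, hγ⟩
  refine ⟨hmem, ?_⟩
  rw [flow, dif_pos hmem]
  obtain ⟨a', b', h0', ht', hv, hγ'⟩ := hmem.choose_spec
  have hs : ∀ r, r ∈ Ioo (max a a') (min b b') ↔ r ∈ Ioo a b ∧ r ∈ Ioo a' b' := by
    intro r
    simp only [mem_Ioo, max_lt_iff, lt_min_iff]
    tauto
  exact hΓ.eqOn_Ioo ((hs 0).2 ⟨h0, h0'⟩) (hγ'.mono fun r hr => ((hs r).1 hr).2)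
    (hγ.mono fun r hr => ((hs r).1 hr).1) hv ((hs t).2 ⟨ht, ht'⟩)

theorem IsSODE.flow_neg_flow (hΓ : IsSODE Γ) {t : ℝ} {v : TB E Q} (hv : v ∈ flowDomain Γ t) :
    flow Γ t v ∈ flowDomain Γ (-t) ∧ flow Γ (-t) (flow Γ t v) = v := by
  obtain ⟨γ, a, b, h0, ht, rfl, hγ⟩ := hv
  have hγt := (hγ.comp_add t).mono (s' := Ioo (a - t) (b - t))
    fun r hr => ⟨by linarith [hr.1], by linarith [hr.2]⟩
  have key := hΓ.flow_eq (t := -t) ⟨by linarith [ht.1], by linarith [ht.2]⟩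
    ⟨by linarith [h0.1], by linarith [h0.2]⟩ hγt
  simp only [Function.comp_apply, zero_add, neg_add_cancel] at key
  rwa [(hΓ.flow_eq h0 ht hγ).2]

theorem IsSODE.flow_flow_neg (hΓ : IsSODE Γ) {t : ℝ} {v : TB E Q} (hv : v ∈ flowDomain Γ (-t)) :
    flow Γ (-t) v ∈ flowDomain Γ t ∧ flow Γ t (flow Γ (-t) v) = v := by
  simpa using hΓ.flow_neg_flow hv

/-- A trajectory on a compact interval is determined by its initial velocity. -/
theorem IsSODE.velocity_eqOn (hΓ : IsSODE Γ) {σ σ' : ℝ → Q} {h : ℝ}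
    (hσ : IsTrajectoryOn Γ σ (Icc 0 h)) (hσ' : IsTrajectoryOn Γ σ' (Icc 0 h))
    (h0 : velocity (E := E) σ (Icc 0 h) 0 = velocity σ' (Icc 0 h) 0) :
    EqOn (velocity (E := E) σ (Icc 0 h)) (velocity σ' (Icc 0 h)) (Icc 0 h) := by
  have : T2Space (TB E Q) := t2Space_TB
  exact eqOn_Icc_of_isMIntegralCurveOn hΓ.smooth hσ.2 hσ'.2 h0

theorem IsSODE.trajectory_eqOn (hΓ : IsSODE Γ) {σ σ' : ℝ → Q} {h : ℝ}
    (hσ : IsTrajectoryOn Γ σ (Icc 0 h)) (hσ' : IsTrajectoryOn Γ σ' (Icc 0 h))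
    (h0 : velocity (E := E) σ (Icc 0 h) 0 = velocity σ' (Icc 0 h) 0) : EqOn σ σ' (Icc 0 h) :=
  fun _ ht => congrArg Bundle.TotalSpace.proj (hΓ.velocity_eqOn hσ hσ' h0 ht)

theorem IsSODE.exists_trajectory (hΓ : IsSODE Γ) {h : ℝ} (hh : 0 < h) {v : TB E Q}
    (hv : v ∈ flowDomain Γ h) :
    ∃ σ : ℝ → Q, IsTrajectoryOn Γ σ (Icc 0 h) ∧ velocity (E := E) σ (Icc 0 h) 0 = v ∧
      velocity (E := E) σ (Icc 0 h) h = flow Γ h v := by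
  obtain ⟨γ, a, b, h0, ht, rfl, hγ⟩ := hv
  have hs : Icc 0 h ⊆ Ioo a b := fun r hr => ⟨h0.1.trans_le hr.1, hr.2.trans_lt ht.2⟩
  have hγ' := hγ.mono hs
  have hu := uniqueDiffOn_Icc hh
  refine ⟨fun r => (γ r).proj, hΓ.isTrajectoryOn_proj hu hγ', ?_, ?_⟩
  · exact hΓ.velocity_proj (hu 0 ⟨le_rfl, hh.le⟩) (hγ' 0 ⟨le_rfl, hh.le⟩)
  · rw [(hΓ.flow_eq h0 ht hγ).2]
    exact hΓ.velocity_proj (hu h ⟨hh.le, le_rfl⟩) (hγ' h ⟨hh.le, le_rfl⟩)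

end Flow

/-! ### The flow near the zero vector at a point -/

section LocalFlowInChart
open Topology

variable {E : Type*} [NormedAddCommGroup E] [NormedSpace ℝ E]
  {Q : Type*} [TopologicalSpace Q] [ChartedSpace E Q] [IsManifold 𝓘(ℝ, E) ∞ Q]
  {Γ : VectorFieldOnTB E Q} {q₀ : Q}

variable (E) in
/-- The natural chart of `TQ` around the zero vector at `q₀`. -/
abbrev zeroChart (q₀ : Q) : PartialEquiv (TB E Q) (E × E) :=
  extChartAt 𝓘(ℝ, E).tangent (⟨q₀, 0⟩ : TB E Q)

theorem zeroChart_symm_base (w : TangentSpace 𝓘(ℝ, E) q₀) :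
    (zeroChart E q₀).symm (extChartAt 𝓘(ℝ, E) q₀ q₀, w) = (⟨q₀, w⟩ : TB E Q) := by
  refine (congrArg (zeroChart E q₀).symm (extChartAt_TB_self q₀ w).symm).trans
    ((zeroChart E q₀).left_inv ?_)
  rw [extChartAt_TB_source]
  exact mem_extChartAt_source q₀

/-- Near the zero vector at `q₀` the coordinate expression of `Γ` agrees with a globally defined
smooth field, obtained with a bump function. -/
theorem IsSODE.exists_global_chartField [FiniteDimensional ℝ E] (hΓ : IsSODE Γ) (q₀ : Q) :
    ∃ X : E × E → E × E, ContDiff ℝ ∞ X ∧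
      ∃ Ω ∈ 𝓝 (extChartAt 𝓘(ℝ, E) q₀ q₀, (0 : E)), Ω ⊆ (zeroChart E q₀).target ∧
        EqOn X (chartField (I := 𝓘(ℝ, E).tangent) Γ ⟨q₀, 0⟩) Ω := by
  have hY := contDiffOn_chartField hΓ.smooth (⟨q₀, 0⟩ : TB E Q)
  set Y := chartField (I := 𝓘(ℝ, E).tangent) Γ ⟨q₀, 0⟩
  set z₀ : E × E := (extChartAt 𝓘(ℝ, E) q₀ q₀, 0)
  have hopen : IsOpen (zeroChart E q₀).target := isOpen_extChartAt_target _
  have hz₀ : z₀ ∈ (zeroChart E q₀).target := by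
    have h := mem_extChartAt_target (I := 𝓘(ℝ, E).tangent) (⟨q₀, 0⟩ : TB E Q)
    have h' := extChartAt_TB_self q₀ (0 : TangentSpace 𝓘(ℝ, E) q₀)
    rw [h'] at h
    exact h
  obtain ⟨r, hr, hrt⟩ := Metric.isOpen_iff.1 hopen z₀ hz₀
  let χ : ContDiffBump z₀ := ⟨r / 4, r / 2, by positivity, by linarith⟩
  have hsub : tsupport χ ⊆ (zeroChart E q₀).target := by
    rw [χ.tsupport_eq]
    exact (Metric.closedBall_subset_ball (by change r / 2 < r; linarith)).trans hrt
  refine ⟨fun z => χ z • Y z, ?_, Metric.ball z₀ (r / 4), Metric.ball_mem_nhds _ (by positivity),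
    (Metric.ball_subset_ball (by linarith)).trans hrt, ?_⟩
  · rw [contDiff_iff_contDiffAt]
    intro z
    by_cases hz : z ∈ tsupport χ
    · exact χ.contDiffAt.smul (hY.contDiffAt (hopen.mem_nhds (hsub hz)))
    · refine (contDiffAt_const (c := (0 : E × E))).congr_of_eventuallyEq ?_
      filter_upwards [(isClosed_tsupport χ).isOpen_compl.mem_nhds hz] with y hy
      rw [image_eq_zero_of_notMem_tsupport hy, zero_smul]
  · intro z hz
    simp only
    rw [χ.one_of_mem_closedBall (Metric.ball_subset_closedBall hz), one_smul]

variable {X : E × E → E × E} {Ω : Set (E × E)} {N : Set (ℝ × E × E)}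
  {c : ℝ × E × E → ℝ → E × E} {e : OpenPartialHomeomorph (ℝ × E × E) (ℝ × E × E)}

/-- The rescaled coordinate curves give integral curves of `Γ` in real time `t = h s`. -/
theorem IsLocalFlow.isMIntegralCurveOn (hL : IsLocalFlow X (extChartAt 𝓘(ℝ, E) q₀ q₀) Ω N c e)
    (hΩ : Ω ⊆ (zeroChart E q₀).target)
    (hX : EqOn X (chartField (I := 𝓘(ℝ, E).tangent) Γ ⟨q₀, 0⟩) Ω) {p : ℝ × E × E} (hp : p ∈ N)
    (hp0 : p.1 ≠ 0) :
    IsMIntegralCurveOn (I := 𝓘(ℝ, E).tangent)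
      (fun t => (zeroChart E q₀).symm (c p (t / p.1))) Γ (Ioo (-(2 * |p.1|)) (2 * |p.1|)) := by
  have : IsManifold 𝓘(ℝ, E).tangent 1 (TB E Q) := .of_le (n := ∞) (by exact_mod_cast le_top)
  intro t ht
  have hs : t / p.1 ∈ Ioo (-2 : ℝ) 2 := by
    rw [mem_Ioo, ← abs_lt] at ht ⊢
    rwa [abs_div, div_lt_iff₀ (abs_pos.2 hp0)]
  have hmem := hL.mem p hp (t / p.1)
  have h1 : HasDerivAt (fun t => c p (t / p.1)) (X (c p (t / p.1))) t := by
    have := (hL.hasDerivAt p hp _ hs).scomp t ((hasDerivAt_id t).div_const p.1)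
    rwa [smul_smul, one_div, inv_mul_cancel₀ hp0, one_smul] at this
  rw [hX hmem] at h1
  exact hasMFDerivWithinAt_of_chart (⟨q₀, 0⟩ : TB E Q) h1.hasDerivWithinAt (hΩ hmem)

theorem IsLocalFlow.flow_eq [T2Space Q] (hL : IsLocalFlow X (extChartAt 𝓘(ℝ, E) q₀ q₀) Ω N c e)
    (hΓ : IsSODE Γ) (hΩ : Ω ⊆ (zeroChart E q₀).target)
    (hX : EqOn X (chartField (I := 𝓘(ℝ, E).tangent) Γ ⟨q₀, 0⟩) Ω) {h : ℝ} (hh : h ≠ 0) {z : E × E}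
    (hp : (h, z) ∈ N) :
    (zeroChart E q₀).symm z ∈ flowDomain Γ h ∧
      flow Γ h ((zeroChart E q₀).symm z) = (zeroChart E q₀).symm (c (h, z) 1) := by
  have hpos := abs_pos.2 hh
  have h1 := hΓ.flow_eq (t := h) ⟨by simpa using hh, by simpa using hh⟩
    ⟨by change -(2 * |h|) < h; linarith [neg_abs_le h],
      by change h < 2 * |h|; linarith [le_abs_self h]⟩
    (hL.isMIntegralCurveOn hΩ hX hp hh)
  simpa only [zero_div, div_self hh, hL.start _ hp] using h1

/-- The flow is smooth where it is given by the local flow in the chart. -/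
theorem IsLocalFlow.contMDiffOn_flow [T2Space Q]
    (hL : IsLocalFlow X (extChartAt 𝓘(ℝ, E) q₀ q₀) Ω N c e)
    (hΓ : IsSODE Γ) (hΩ : Ω ⊆ (zeroChart E q₀).target)
    (hX : EqOn X (chartField (I := 𝓘(ℝ, E).tangent) Γ ⟨q₀, 0⟩) Ω) {h : ℝ} (hh : h ≠ 0) :
    IsOpen ((zeroChart E q₀).source ∩ zeroChart E q₀ ⁻¹' {z | (h, z) ∈ N}) ∧
    ContMDiffOn 𝓘(ℝ, E).tangent 𝓘(ℝ, E).tangent ∞ (flow Γ h)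
      ((zeroChart E q₀).source ∩ zeroChart E q₀ ⁻¹' {z | (h, z) ∈ N}) := by
  refine ⟨(continuousOn_extChartAt _).isOpen_inter_preimage (isOpen_extChartAt_source _)
    (hL.isOpen.preimage (Continuous.prodMk_right h)), ?_⟩
  have h1 : ContMDiffOn 𝓘(ℝ, E).tangent 𝓘(ℝ, E × E) ∞ (zeroChart E q₀)
      ((zeroChart E q₀).source ∩ zeroChart E q₀ ⁻¹' {z | (h, z) ∈ N}) :=
    (contMDiffOn_extChartAt (n := ∞)).mono fun v hv => by simpa using hv.1
  have h2 : ContDiffOn ℝ ∞ (fun z : E × E => c (h, z) 1) {z | (h, z) ∈ N} :=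
    hL.smooth_end.comp (contDiff_prodMk_right h).contDiffOn fun z hz => hz
  have h3 := (contMDiffOn_extChartAt_symm (n := ∞) (I := 𝓘(ℝ, E).tangent) (⟨q₀, 0⟩ : TB E Q)).comp
    (h2.contMDiffOn.comp h1 inter_subset_right) fun v hv => hΩ (hL.mem _ hv.2 1)
  refine h3.congr fun v hv => ?_
  have h4 := (hL.flow_eq hΓ hΩ hX hh hv.2).2
  rwa [(zeroChart E q₀).left_inv hv.1] at h4

end LocalFlowInChart

/-! ### The exact retraction maps -/

section Retraction
open Topology

variable {E : Type*} [NormedAddCommGroup E] [NormedSpace ℝ E]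
  {Q : Type*} [TopologicalSpace Q] [ChartedSpace E Q] [IsManifold 𝓘(ℝ, E) ∞ Q]
  {Γ : VectorFieldOnTB E Q} {q₀ : Q}
  {X : E × E → E × E} {Ω : Set (E × E)} {N : Set (ℝ × E × E)}
  {c : ℝ × E × E → ℝ → E × E} {e : OpenPartialHomeomorph (ℝ × E × E) (ℝ × E × E)}

theorem IsLocalFlow.mem_target (hL : IsLocalFlow X (extChartAt 𝓘(ℝ, E) q₀ q₀) Ω N c e)
    (hΩ : Ω ⊆ (zeroChart E q₀).target) {p : ℝ × E × E} (hp : p ∈ e.source) :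
    p.2 ∈ (zeroChart E q₀).target := by
  have h1 := hL.source_subset hp
  rw [← hL.start p h1]
  exact hΩ (hL.mem p h1 0)

variable [T2Space Q]

theorem IsSODE.velocity_end (hΓ : IsSODE Γ) {h : ℝ} (hh : 0 < h) {σ : ℝ → Q}
    (hσ : IsTrajectoryOn Γ σ (Icc 0 h))
    (h0 : velocity (E := E) σ (Icc 0 h) 0 ∈ flowDomain Γ h) :
    velocity (E := E) σ (Icc 0 h) h = flow Γ h (velocity (E := E) σ (Icc 0 h) 0) := by
  obtain ⟨σ', hσ', hs, he⟩ := hΓ.exists_trajectory hh h0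
  rw [← he]
  exact hΓ.velocity_eqOn hσ hσ' hs.symm ⟨hh.le, le_rfl⟩

/-- In the chart, `e (h, ·)` reads off the two components of the exponential map. -/
theorem IsLocalFlow.map_eq (hL : IsLocalFlow X (extChartAt 𝓘(ℝ, E) q₀ q₀) Ω N c e)
    (hΓ : IsSODE Γ) (hΩ : Ω ⊆ (zeroChart E q₀).target)
    (hX : EqOn X (chartField (I := 𝓘(ℝ, E).tangent) Γ ⟨q₀, 0⟩) Ω) {h : ℝ} (hh : h ≠ 0)
    {v : TB E Q} (hv : v ∈ (zeroChart E q₀).source) (hp : (h, zeroChart E q₀ v) ∈ e.source) :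
    v.proj ∈ (extChartAt 𝓘(ℝ, E) q₀).source ∧
    (flow Γ h v).proj ∈ (extChartAt 𝓘(ℝ, E) q₀).source ∧
    e (h, zeroChart E q₀ v) = (h, extChartAt 𝓘(ℝ, E) q₀ v.proj,
      h⁻¹ • (extChartAt 𝓘(ℝ, E) q₀ (flow Γ h v).proj - extChartAt 𝓘(ℝ, E) q₀ v.proj)) := by
  have hN := hL.source_subset hp
  have hflow := (hL.flow_eq hΓ hΩ hX hh hN).2
  rw [(zeroChart E q₀).left_inv hv] at hflow
  obtain ⟨hproj, htgt⟩ := extChartAt_TB_symm_proj _ (hΩ (hL.mem _ hN 1))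
  rw [← hflow] at hproj
  refine ⟨by rwa [extChartAt_TB_source] at hv, ?_, ?_⟩
  · rw [hproj]
    exact (extChartAt 𝓘(ℝ, E) q₀).map_target htgt
  · refine Prod.ext (hL.map_fst _ hp) (Prod.ext (hL.map_snd_fst _ hp) ?_)
    have h1 : extChartAt 𝓘(ℝ, E) q₀ (flow Γ h v).proj = (c (h, zeroChart E q₀ v) 1).1 := by
      rw [hproj]
      exact (extChartAt 𝓘(ℝ, E) q₀).right_inv htgt
    have h2 : (zeroChart E q₀ v).1 = extChartAt 𝓘(ℝ, E) q₀ v.proj := extChartAt_TB_fst _ v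
    simp only
    rw [h1, hL.end_fst _ hp, h2, add_sub_cancel_left, smul_smul, inv_mul_cancel₀ hh, one_smul]

/-- For a fixed small time step `h`, inverting `e (h, ·)` in the chart gives the exact retraction
maps on a product neighbourhood `U × U` of `(q₀, q₀)`. -/
theorem IsLocalFlow.exists_retraction (hL : IsLocalFlow X (extChartAt 𝓘(ℝ, E) q₀ q₀) Ω N c e)
    (hΓ : IsSODE Γ) (hΩ : Ω ⊆ (zeroChart E q₀).target)
    (hX : EqOn X (chartField (I := 𝓘(ℝ, E).tangent) Γ ⟨q₀, 0⟩) Ω) {h : ℝ} (hh : 0 < h)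
    (hT : (h, extChartAt 𝓘(ℝ, E) q₀ q₀, 0) ∈ e.target) :
    ∃ (𝒰 : Set (TB E Q)) (U : Set Q) (Rminus Rplus : Q × Q → TB E Q),
      IsOpen 𝒰 ∧ 𝒰 ⊆ flowDomain Γ h ∧
      (zeroChart E q₀).symm (e.symm (h, extChartAt 𝓘(ℝ, E) q₀ q₀, 0)).2 ∈ 𝒰 ∧
      IsOpen U ∧ q₀ ∈ U ∧
      IsDiffeoWithInverse 𝓘(ℝ, E).tangent (𝓘(ℝ, E).prod 𝓘(ℝ, E))
        (expMap Γ h) Rminus 𝒰 (U ×ˢ U) ∧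
      flow Γ h '' 𝒰 ⊆ flowDomain Γ (-h) ∧
      IsDiffeoWithInverse 𝓘(ℝ, E).tangent (𝓘(ℝ, E).prod 𝓘(ℝ, E))
        (expMap Γ h ∘ flow Γ (-h)) Rplus (flow Γ h '' 𝒰) (U ×ˢ U) ∧
      EqOn Rplus (flow Γ h ∘ Rminus) (U ×ˢ U) := by
  have hh0 : h ≠ 0 := hh.ne'
  let κ := extChartAt 𝓘(ℝ, E) q₀
  let ρ := zeroChart E q₀
  let D : Set (Q × Q) := κ.source ×ˢ κ.source
  have hD : IsOpen D := (isOpen_extChartAt_source q₀).prod (isOpen_extChartAt_source q₀)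
  let G : Q × Q → ℝ × E × E := fun x => (h, κ x.1, h⁻¹ • (κ x.2 - κ x.1))
  have hG : ContMDiffOn (𝓘(ℝ, E).prod 𝓘(ℝ, E)) 𝓘(ℝ, ℝ × E × E) ∞ G D := by
    have hκ : ContMDiffOn 𝓘(ℝ, E) 𝓘(ℝ, E) ∞ κ κ.source := by
      have := contMDiffOn_extChartAt (I := 𝓘(ℝ, E)) (n := ∞) (x := q₀)
      rwa [← extChartAt_source 𝓘(ℝ, E)] at this
    have h1 : ContMDiffOn (𝓘(ℝ, E).prod 𝓘(ℝ, E)) 𝓘(ℝ, E × E) ∞ (fun x => (κ x.1, κ x.2)) D :=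
      (hκ.comp contMDiffOn_fst fun x hx => hx.1).prodMk_space
        (hκ.comp contMDiffOn_snd fun x hx => hx.2)
    have h2 : ContDiff ℝ ∞ (fun y : E × E => (h, y.1, h⁻¹ • (y.2 - y.1))) := by fun_prop
    exact h2.contMDiff.comp_contMDiffOn h1
  have hG0 : G (q₀, q₀) = (h, κ q₀, 0) := by simp [G]
  have hWo : IsOpen (D ∩ G ⁻¹' e.target) :=
    hG.continuousOn.isOpen_inter_preimage hD e.open_target
  have hWm : (q₀, q₀) ∈ D ∩ G ⁻¹' e.target := by
    refine ⟨⟨mem_extChartAt_source q₀, mem_extChartAt_source q₀⟩, ?_⟩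
    rw [mem_preimage, hG0]
    exact hT
  obtain ⟨u, u', hu, hu', hqu, hqu', huu⟩ := isOpen_prod_iff.1 hWo q₀ q₀ hWm
  let U := u ∩ u'
  have hUo : IsOpen U := hu.inter hu'
  have hqU : q₀ ∈ U := ⟨hqu, hqu'⟩
  have hUW : U ×ˢ U ⊆ D ∩ G ⁻¹' e.target := fun x hx => huu ⟨hx.1.1, hx.2.2⟩
  let R : Q × Q → TB E Q := fun x => ρ.symm (e.symm (G x)).2
  -- the vectors in the domain of the chart to which `e` applies
  let S : Set (TB E Q) := ρ.source ∩ ρ ⁻¹' {z | (h, z) ∈ e.source}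
  have hS : IsOpen S :=
    (continuousOn_extChartAt _).isOpen_inter_preimage (isOpen_extChartAt_source _)
      (e.open_source.preimage (Continuous.prodMk_right h))
  obtain ⟨-, hflow⟩ := hL.contMDiffOn_flow hΓ hΩ hX hh0
  obtain ⟨hBo, hback⟩ := hL.contMDiffOn_flow hΓ hΩ hX (neg_ne_zero.2 hh0)
  have hflowS : ContMDiffOn 𝓘(ℝ, E).tangent 𝓘(ℝ, E).tangent ∞ (flow Γ h) S :=
    hflow.mono fun v hv => ⟨hv.1, hL.source_subset hv.2⟩
  have hproj : ContMDiff 𝓘(ℝ, E).tangent 𝓘(ℝ, E) ∞ (fun w : TB E Q => w.proj) :=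
    Bundle.contMDiff_proj (n := ∞) (IB := 𝓘(ℝ, E)) (TangentSpace 𝓘(ℝ, E) (M := Q))
  have hexp : ContMDiffOn 𝓘(ℝ, E).tangent (𝓘(ℝ, E).prod 𝓘(ℝ, E)) ∞ (expMap Γ h) S :=
    hproj.contMDiffOn.prodMk (hproj.comp_contMDiffOn hflowS)
  let 𝒰 : Set (TB E Q) := S ∩ expMap Γ h ⁻¹' (U ×ˢ U)
  have h𝒰 : IsOpen 𝒰 := hexp.continuousOn.isOpen_inter_preimage hS (hUo.prod hUo)
  have hdom : 𝒰 ⊆ flowDomain Γ h := by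
    intro v hv
    have h1 := (hL.flow_eq hΓ hΩ hX hh0 (hL.source_subset hv.1.2)).1
    rwa [(zeroChart E q₀).left_inv hv.1.1] at h1
  have hRS : ∀ x ∈ U ×ˢ U, R x ∈ S ∧ expMap Γ h (R x) = x := by
    intro x hx
    obtain ⟨hxD, hxT⟩ := hUW hx
    have hp : e.symm (G x) ∈ e.source := e.map_target hxT
    have hp1 : (e.symm (G x)).1 = h := by
      rw [← hL.map_fst _ hp, e.right_inv hxT]
    have ht := hL.mem_target hΩ hp
    have hρ : ρ (R x) = (e.symm (G x)).2 := ρ.right_inv ht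
    have hpair : (h, ρ (R x)) = e.symm (G x) := Prod.ext hp1.symm hρ
    have hs : R x ∈ ρ.source := ρ.map_target ht
    have hS' : (h, ρ (R x)) ∈ e.source := hpair ▸ hp
    obtain ⟨m1, m2, m3⟩ := hL.map_eq hΓ hΩ hX hh0 hs hS'
    have m4 := (congrArg e hpair).symm.trans m3
    rw [e.right_inv hxT] at m4
    have m5 : κ x.1 = κ (R x).proj := congrArg (fun y => y.2.1) m4
    have m6 : h⁻¹ • (κ x.2 - κ x.1) = h⁻¹ • (κ (flow Γ h (R x)).proj - κ (R x).proj) :=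
      congrArg (fun y => y.2.2) m4
    have m7 : κ x.2 = κ (flow Γ h (R x)).proj := by
      have := smul_right_injective E (inv_ne_zero hh0) m6
      rw [m5] at this
      exact sub_left_injective this
    exact ⟨⟨hs, hS'⟩, Prod.ext (κ.injOn m1 hxD.1 m5.symm) (κ.injOn m2 hxD.2 m7.symm)⟩
  have hRmem : MapsTo R (U ×ˢ U) 𝒰 := by
    intro x hx
    obtain ⟨h1, h2⟩ := hRS x hx
    exact ⟨h1, by rw [mem_preimage, h2]; exact hx⟩
  have hleft : LeftInvOn R (expMap Γ h) 𝒰 := by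
    intro v hv
    obtain ⟨-, -, m3⟩ := hL.map_eq hΓ hΩ hX hh0 hv.1.1 hv.1.2
    have h1 : e.symm (G (expMap Γ h v)) = (h, ρ v) :=
      (congrArg e.symm m3.symm).trans (e.left_inv hv.1.2)
    change ρ.symm (e.symm (G (expMap Γ h v))).2 = v
    rw [h1]
    exact ρ.left_inv hv.1.1
  have hRsmooth : ContMDiffOn (𝓘(ℝ, E).prod 𝓘(ℝ, E)) 𝓘(ℝ, E).tangent ∞ R (U ×ˢ U) := by
    have h1 : ContDiffOn ℝ ∞ (fun y => (e.symm y).2) e.target := hL.smooth_symm.snd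
    exact (contMDiffOn_extChartAt_symm (n := ∞) (I := 𝓘(ℝ, E).tangent) (⟨q₀, 0⟩ : TB E Q)).comp
      (h1.contMDiffOn.comp (hG.mono fun x hx => (hUW hx).1) fun x hx => (hUW hx).2)
      fun x hx => hL.mem_target hΩ (e.map_target (hUW hx).2)
  have hinv : ∀ v ∈ 𝒰, flow Γ (-h) (flow Γ h v) = v := fun v hv => (hΓ.flow_neg_flow (hdom hv)).2
  -- the image of `𝒰` under the flow lies in the region where the backward flow is controlled
  have himg : ∀ v ∈ 𝒰, flow Γ h v ∈ ρ.source ∩ ρ ⁻¹' {z | (-h, z) ∈ N} := by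
    intro v hv
    have hN := hL.source_subset hv.1.2
    have h1 := (hL.flow_eq hΓ hΩ hX hh0 hN).2
    rw [(zeroChart E q₀).left_inv hv.1.1] at h1
    have ht := hΩ (hL.mem _ hN 1)
    rw [h1]
    refine ⟨ρ.map_target ht, ?_⟩
    have h2 : ρ (ρ.symm (c (h, ρ v) 1)) = c (h, ρ v) 1 := ρ.right_inv ht
    change (-h, ρ (ρ.symm (c (h, ρ v) 1))) ∈ N
    rw [h2]
    exact hL.back_mem _ hv.1.2
  have himage : flow Γ h '' 𝒰 =
      (ρ.source ∩ ρ ⁻¹' {z | (-h, z) ∈ N}) ∩ flow Γ (-h) ⁻¹' 𝒰 := by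
    ext y
    constructor
    · rintro ⟨v, hv, rfl⟩
      exact ⟨himg v hv, by rw [mem_preimage, hinv v hv]; exact hv⟩
    · rintro ⟨hy, hy'⟩
      have h1 := (hL.flow_eq hΓ hΩ hX (neg_ne_zero.2 hh0) hy.2).1
      rw [(zeroChart E q₀).left_inv hy.1] at h1
      exact ⟨_, hy', (hΓ.flow_flow_neg h1).2⟩
  refine ⟨𝒰, U, R, flow Γ h ∘ R, h𝒰, hdom, ?_, hUo, hqU,
    ⟨h𝒰, hUo.prod hUo, fun v hv => hv.2, hRmem, hleft, fun x hx => (hRS x hx).2,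
      hexp.mono inter_subset_left, hRsmooth⟩, ?_,
    ⟨?_, hUo.prod hUo, ?_, fun x hx => ⟨_, hRmem hx, rfl⟩, ?_, ?_, ?_, ?_⟩, fun _ _ => rfl⟩
  · have h1 := hRmem (x := (q₀, q₀)) ⟨hqU, hqU⟩
    change ρ.symm (e.symm (G (q₀, q₀))).2 ∈ 𝒰 at h1
    rwa [hG0] at h1
  · rintro _ ⟨v, hv, rfl⟩
    exact (hΓ.flow_neg_flow (hdom hv)).1
  · rw [himage]
    exact hback.continuousOn.isOpen_inter_preimage hBo h𝒰
  · rintro _ ⟨v, hv, rfl⟩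
    rw [Function.comp_apply, hinv v hv]
    exact hv.2
  · rintro _ ⟨v, hv, rfl⟩
    rw [Function.comp_apply, Function.comp_apply, hinv v hv, hleft hv]
  · intro x hx
    rw [Function.comp_apply, Function.comp_apply, hinv _ (hRmem hx), (hRS x hx).2]
  · refine (hexp.mono inter_subset_left).comp (t := 𝒰)
      (hback.mono (himage ▸ inter_subset_left)) ?_
    rw [himage]
    exact inter_subset_right
  · exact hflowS.comp hRsmooth fun x hx => (hRmem hx).1

end Retraction

/-! ### Loops and joining trajectories -/

section Existence
open Topology

variable {E : Type*} [NormedAddCommGroup E] [NormedSpace ℝ E]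
  {Q : Type*} [TopologicalSpace Q] [ChartedSpace E Q] [IsManifold 𝓘(ℝ, E) ∞ Q] [T2Space Q]
  {Γ : VectorFieldOnTB E Q} {q₀ : Q}
  {X : E × E → E × E} {Ω : Set (E × E)} {N : Set (ℝ × E × E)}
  {c : ℝ × E × E → ℝ → E × E} {e : OpenPartialHomeomorph (ℝ × E × E) (ℝ × E × E)}

/-- The loop at `q₀` of duration `h` with velocities in `K` is the solution of zero mean velocity;
it is unique because `e` is injective. -/
theorem IsLocalFlow.exists_loop (hL : IsLocalFlow X (extChartAt 𝓘(ℝ, E) q₀ q₀) Ω N c e)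
    (hΓ : IsSODE Γ) (hΩ : Ω ⊆ (zeroChart E q₀).target)
    (hX : EqOn X (chartField (I := 𝓘(ℝ, E).tangent) Γ ⟨q₀, 0⟩) Ω) {h : ℝ} (hh : 0 < h)
    (hT : (h, extChartAt 𝓘(ℝ, E) q₀ q₀, 0) ∈ e.target) {K' : Set (E × E)}
    (hK' : ∀ z ∈ K', (h, z) ∈ e.source)
    (hc : ∀ s, c (e.symm (h, extChartAt 𝓘(ℝ, E) q₀ q₀, 0)) s ∈ K') {C : Set Q}
    (hC : Bundle.TotalSpace.proj '' ((zeroChart E q₀).symm '' K') ⊆ C) :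
    (zeroChart E q₀).symm (e.symm (h, extChartAt 𝓘(ℝ, E) q₀ q₀, 0)).2 ∈
      (zeroChart E q₀).symm '' K' ∧
    ∃ σ : ℝ → Q, IsLoopIn Γ q₀ h C ((zeroChart E q₀).symm '' K') σ ∧
      velocity σ (Icc 0 h) 0 =
        (zeroChart E q₀).symm (e.symm (h, extChartAt 𝓘(ℝ, E) q₀ q₀, 0)).2 ∧
      ∀ σ' : ℝ → Q, IsLoopIn Γ q₀ h C ((zeroChart E q₀).symm '' K') σ' →
        EqOn σ' σ (Icc 0 h) := by
  have hh0 : h ≠ 0 := hh.ne'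
  let ρ := zeroChart E q₀
  set x₀ := extChartAt 𝓘(ℝ, E) q₀ q₀ with hx₀
  set p := e.symm (h, x₀, 0) with hp_def
  have hp : p ∈ e.source := e.map_target hT
  have hep : e p = (h, x₀, 0) := e.right_inv hT
  have hp1 : p.1 = h := by rw [← hL.map_fst _ hp, hep]
  have hpN := hL.source_subset hp
  have hpp : (h, p.2) = p := Prod.ext hp1.symm rfl
  let γ : ℝ → TB E Q := fun t => ρ.symm (c p (t / h))
  have hγ : IsMIntegralCurveOn (I := 𝓘(ℝ, E).tangent) γ Γ (Icc 0 h) := by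
    have h1 := hL.isMIntegralCurveOn hΩ hX hpN (hp1 ▸ hh0)
    rw [hp1, abs_of_pos hh] at h1
    exact h1.mono fun t ht => ⟨by linarith [ht.1], by linarith [ht.2]⟩
  have hu := uniqueDiffOn_Icc hh
  have hvel : ∀ t ∈ Icc 0 h, velocity (E := E) (fun r => (γ r).proj) (Icc 0 h) t = γ t :=
    fun t ht => hΓ.velocity_proj (hu t ht) (hγ t ht)
  have hγ0 : γ 0 = ρ.symm p.2 := by
    simp only [γ, zero_div, hL.start p hpN]
  have hγh : γ h = flow Γ h (ρ.symm p.2) := by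
    have h1 := (hL.flow_eq hΓ hΩ hX hh0 (hpp ▸ hpN)).2
    rw [hpp] at h1
    rw [h1]
    simp only [γ, div_self hh0]
    rfl
  have h0mem : (0 : ℝ) ∈ Icc 0 h := ⟨le_rfl, hh.le⟩
  have hhmem : h ∈ Icc 0 h := ⟨hh.le, le_rfl⟩
  have hγK : ∀ t, γ t ∈ ρ.symm '' K' := fun t => ⟨_, hc _, rfl⟩
  have hmem := hL.mem_target hΩ hp
  have hρ : ρ (ρ.symm p.2) = p.2 := ρ.right_inv hmem
  have hs : ρ.symm p.2 ∈ ρ.source := ρ.map_target hmem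
  -- `e p = (h, x₀, 0)` says that both ends of the curve are `q₀`
  obtain ⟨m1, m2, m3⟩ := hL.map_eq hΓ hΩ hX hh0 hs (by rw [hρ, hpp]; exact hp)
  have m4 : e p = _ := (congrArg e (show p = (h, ρ (ρ.symm p.2)) by rw [hρ, hpp])).trans m3
  rw [hep] at m4
  have m5 : x₀ = extChartAt 𝓘(ℝ, E) q₀ (ρ.symm p.2).proj := congrArg (fun y => y.2.1) m4
  have m6 : (0 : E) = h⁻¹ • (extChartAt 𝓘(ℝ, E) q₀ (flow Γ h (ρ.symm p.2)).proj -
      extChartAt 𝓘(ℝ, E) q₀ (ρ.symm p.2).proj) := congrArg (fun y => y.2.2) m4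
  have hq₀ := mem_extChartAt_source (I := 𝓘(ℝ, E)) q₀
  have hstart : (ρ.symm p.2).proj = q₀ := ((extChartAt 𝓘(ℝ, E) q₀).injOn hq₀ m1 m5).symm
  have hfinish : (flow Γ h (ρ.symm p.2)).proj = q₀ := by
    have m7 := sub_eq_zero.1 ((smul_eq_zero.1 m6.symm).resolve_left (inv_ne_zero hh0))
    exact ((extChartAt 𝓘(ℝ, E) q₀).injOn m2 m1 m7).trans hstart
  have hloop : IsLoopIn Γ q₀ h C (ρ.symm '' K') (fun r => (γ r).proj) :=
    { trajectory := hΓ.isTrajectoryOn_proj hu hγ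
      start := by rw [hγ0]; exact hstart
      finish := by rw [hγh]; exact hfinish
      mem := fun t _ => hC ⟨γ t, hγK t, rfl⟩
      velocity_mem := fun t ht => by rw [hvel t ht]; exact hγK t }
  refine ⟨hγ0 ▸ hγK 0, _, hloop, (hvel 0 h0mem).trans hγ0, fun σ' hσ' => ?_⟩
  refine hΓ.trajectory_eqOn hσ'.trajectory hloop.trajectory ?_
  rw [hvel 0 h0mem, hγ0]
  -- the initial velocity of any other loop has the same image `(h, x₀, 0)` under `e`
  obtain ⟨z, hz, hzv⟩ := hσ'.velocity_mem 0 h0mem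
  have hzs := hK' z hz
  have hzt : z ∈ ρ.target := hL.mem_target hΩ hzs
  have hρz : ρ (ρ.symm z) = z := ρ.right_inv hzt
  obtain ⟨-, -, n3⟩ := hL.map_eq hΓ hΩ hX hh0 (ρ.map_target hzt) (by rw [hρz]; exact hzs)
  have hdom : velocity (E := E) σ' (Icc 0 h) 0 ∈ flowDomain Γ h := by
    rw [← hzv]
    exact (hL.flow_eq hΓ hΩ hX hh0 (hL.source_subset hzs)).1
  have hend := hΓ.velocity_end hh hσ'.trajectory hdom
  rw [← hzv] at hend
  have n4 : (ρ.symm z).proj = q₀ := (congrArg Bundle.TotalSpace.proj hzv).trans hσ'.start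
  have n5 : (flow Γ h (ρ.symm z)).proj = q₀ :=
    (congrArg Bundle.TotalSpace.proj hend).symm.trans hσ'.finish
  rw [n4, n5, sub_self, smul_zero, hρz] at n3
  have n6 : (h, z) = p := by
    rw [hp_def, ← e.left_inv hzs, n3]
  rw [← hzv, ← n6]

/-- The exact retraction maps are given by the unique joining trajectories. -/
theorem IsSODE.exists_join (hΓ : IsSODE Γ) {h : ℝ} (hh : 0 < h) {𝒰 : Set (TB E Q)} {U : Set Q}
    {R : Q × Q → TB E Q} (hdom : 𝒰 ⊆ flowDomain Γ h)
    (hR : IsDiffeoWithInverse 𝓘(ℝ, E).tangent (𝓘(ℝ, E).prod 𝓘(ℝ, E))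
      (expMap Γ h) R 𝒰 (U ×ˢ U)) {q q' : Q} (hq : q ∈ U) (hq' : q' ∈ U) :
    ∃ σ : ℝ → Q, IsJoinIn Γ h 𝒰 q q' σ ∧
      (∀ σ' : ℝ → Q, IsJoinIn Γ h 𝒰 q q' σ' → EqOn σ' σ (Icc 0 h)) ∧
      R (q, q') = velocity σ (Icc 0 h) 0 ∧
      flow Γ h (R (q, q')) = velocity σ (Icc 0 h) h := by
  have hx : (q, q') ∈ U ×ˢ U := ⟨hq, hq'⟩
  have hv := hR.mapsTo_inverse hx
  have hexp := hR.rightInvOn hx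
  obtain ⟨σ, hσ, hs, he⟩ := hΓ.exists_trajectory hh (hdom hv)
  refine ⟨σ, ⟨hσ, ?_, ?_, hs ▸ hv⟩, fun σ' hσ' => ?_, hs.symm, he.symm⟩
  · exact (congrArg Bundle.TotalSpace.proj hs).trans (congrArg Prod.fst hexp)
  · exact (congrArg Bundle.TotalSpace.proj he).trans (congrArg Prod.snd hexp)
  · refine hΓ.trajectory_eqOn hσ'.trajectory hσ ?_
    have hend := hΓ.velocity_end hh hσ'.trajectory (hdom hσ'.velocity_mem)
    have h1 : expMap Γ h (velocity (E := E) σ' (Icc 0 h) 0) = (q, q') :=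
      Prod.ext hσ'.start ((congrArg Bundle.TotalSpace.proj hend).symm.trans hσ'.finish)
    rw [hs, ← h1, hR.leftInvOn hσ'.velocity_mem]

end Existence

end SODE

end

theorem theorem2p4 {E : Type*} [NormedAddCommGroup E] [NormedSpace ℝ E] [FiniteDimensional ℝ E]
    {Q : Type*} [TopologicalSpace Q] [T2Space Q] [ChartedSpace E Q] [IsManifold 𝓘(ℝ, E) ∞ Q]
    (Γ : SODE.VectorFieldOnTB E Q) (hΓ : SODE.IsSODE Γ) (q₀ : Q) :
    ∃ (h₀ : ℝ) (v : ℝ → TangentSpace 𝓘(ℝ, E) q₀) (C : Set Q) (K : Set (SODE.TB E Q)),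
      0 < h₀ ∧ IsCompact C ∧ IsCompact K ∧ q₀ ∈ C ∧
      ∀ h : ℝ, 0 < h → h ≤ h₀ →
        -- the tangent vector `v h` is the initial velocity of the unique loop at `q₀` in `C`, `K`
        (⟨q₀, v h⟩ : SODE.TB E Q) ∈ K ∧
        (∃ σ : ℝ → Q, SODE.IsLoopIn Γ q₀ h C K σ ∧
          SODE.velocity σ (Icc 0 h) 0 = (⟨q₀, v h⟩ : SODE.TB E Q) ∧
          ∀ σ' : ℝ → Q, SODE.IsLoopIn Γ q₀ h C K σ' → EqOn σ' σ (Icc 0 h)) ∧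
        ∃ (𝒰 : Set (SODE.TB E Q)) (U : Set Q) (Rminus Rplus : Q × Q → SODE.TB E Q),
          IsOpen 𝒰 ∧ 𝒰 ⊆ SODE.flowDomain Γ h ∧ (⟨q₀, v h⟩ : SODE.TB E Q) ∈ 𝒰 ∧
          IsOpen U ∧ q₀ ∈ U ∧
          -- the exponential map is a diffeomorphism, with inverse `Rminus`
          SODE.IsDiffeoWithInverse 𝓘(ℝ, E).tangent (𝓘(ℝ, E).prod 𝓘(ℝ, E))
            (SODE.expMap Γ h) Rminus 𝒰 (U ×ˢ U) ∧
          -- so is its composition with the backward flow, with inverse `Rplus`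
          SODE.flow Γ h '' 𝒰 ⊆ SODE.flowDomain Γ (-h) ∧
          SODE.IsDiffeoWithInverse 𝓘(ℝ, E).tangent (𝓘(ℝ, E).prod 𝓘(ℝ, E))
            (SODE.expMap Γ h ∘ SODE.flow Γ (-h)) Rplus (SODE.flow Γ h '' 𝒰) (U ×ˢ U) ∧
          EqOn Rplus (SODE.flow Γ h ∘ Rminus) (U ×ˢ U) ∧
          -- unique trajectories between the points of `U`, and their end velocities
          ∀ q ∈ U, ∀ q' ∈ U, ∃ σ : ℝ → Q, SODE.IsJoinIn Γ h 𝒰 q q' σ ∧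
            (∀ σ' : ℝ → Q, SODE.IsJoinIn Γ h 𝒰 q q' σ' → EqOn σ' σ (Icc 0 h)) ∧
            Rminus (q, q') = SODE.velocity σ (Icc 0 h) 0 ∧
            Rplus (q, q') = SODE.velocity σ (Icc 0 h) h := by
  have : CompleteSpace E := FiniteDimensional.complete ℝ E
  obtain ⟨X, hXs, Ω, hΩn, hΩ, hX⟩ := hΓ.exists_global_chartField q₀
  obtain ⟨N, c, e, hL⟩ := SODE.exists_isLocalFlow hXs (extChartAt 𝓘(ℝ, E) q₀ q₀) hΩn
    fun z hz => by rw [hX hz]; exact hΓ.chartField_fst _ (hΩ hz)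
  set x₀ := extChartAt 𝓘(ℝ, E) q₀ q₀ with hx₀
  let ρ := SODE.zeroChart E q₀
  obtain ⟨u, hu, w, hw, huw⟩ :=
    mem_nhds_prod_iff.1 (e.open_source.mem_nhds hL.base_mem)
  have : ProperSpace (E × E) := FiniteDimensional.proper ℝ _
  obtain ⟨K', hK'n, hK'w, hK'c⟩ := local_compact_nhds hw
  have hK't : K' ⊆ ρ.target := fun z hz =>
    hL.mem_target hΩ (huw (Set.mk_mem_prod (mem_of_mem_nhds hu) (hK'w hz)))
  have hKc : IsCompact (ρ.symm '' K') :=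
    hK'c.image_of_continuousOn ((continuousOn_extChartAt_symm _).mono hK't)
  have hproj : Continuous (Bundle.TotalSpace.proj : SODE.TB E Q → Q) :=
    FiberBundle.continuous_proj E (TangentSpace 𝓘(ℝ, E))
  have hbt : (0, x₀, 0) ∈ e.target := by
    have := e.map_source hL.base_mem
    rwa [hL.map_base] at this
  have hbs : e.symm (0, x₀, 0) = (0, x₀, 0) := by
    have := e.left_inv hL.base_mem
    rwa [hL.map_base] at this
  -- conditions on the time step that hold for all small `h`
  have hev : ∀ᶠ h : ℝ in nhds 0, h ∈ u ∧ (h, x₀, (0 : E)) ∈ e.target ∧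
      ∀ s, c (e.symm (h, x₀, 0)) s ∈ K' := by
    have hj : Filter.Tendsto (fun h : ℝ => (h, x₀, (0 : E))) (nhds 0) (nhds (0, x₀, 0)) :=
      (Continuous.prodMk_left (x₀, (0 : E))).tendsto 0
    have hes : Filter.Tendsto e.symm (nhds (0, x₀, 0)) (nhds (0, x₀, 0)) := by
      have := e.symm.continuousAt hbt
      rwa [ContinuousAt, hbs] at this
    exact (Filter.eventually_mem_set.2 hu).and
      ((hj.eventually (e.open_target.mem_nhds hbt)).and
        ((hes.comp hj).eventually (hL.small K' hK'n)))
  obtain ⟨ε, hε, hball⟩ := Metric.eventually_nhds_iff_ball.1 hev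
  refine ⟨ε / 2, fun h => (e.symm (h, x₀, 0)).2.2, Bundle.TotalSpace.proj '' (ρ.symm '' K'),
    ρ.symm '' K', by positivity, hKc.image hproj, hKc, ?_, ?_⟩
  · refine ⟨_, ⟨(x₀, 0), mem_of_mem_nhds hK'n, rfl⟩, ?_⟩
    exact congrArg Bundle.TotalSpace.proj
      (SODE.zeroChart_symm_base (0 : TangentSpace 𝓘(ℝ, E) q₀))
  · intro h hh hhε
    obtain ⟨hhu, hT, hc⟩ := hball h (by
      rw [Metric.mem_ball, Real.dist_eq, sub_zero, abs_of_pos hh]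
      linarith)
    have hbase : ρ.symm (e.symm (h, x₀, 0)).2 =
        (⟨q₀, (e.symm (h, x₀, 0)).2.2⟩ : SODE.TB E Q) := by
      have h1 : (e.symm (h, x₀, 0)).2.1 = x₀ := by
        rw [← hL.map_snd_fst _ (e.map_target hT), e.right_inv hT]
      have h2 : (e.symm (h, x₀, 0)).2 = (x₀, (e.symm (h, x₀, 0)).2.2) := Prod.ext h1 rfl
      exact (congrArg ρ.symm h2).trans (SODE.zeroChart_symm_base _)
    obtain ⟨hvK, σ, hσ, hσ0, hσu⟩ := hL.exists_loop hΓ hΩ hX hh hT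
      (fun z hz => huw (Set.mk_mem_prod hhu (hK'w hz))) hc subset_rfl
    obtain ⟨𝒰, U, R, R', h𝒰, hdom, hv𝒰, hU, hqU, hR, hback, hR', hRR'⟩ :=
      hL.exists_retraction hΓ hΩ hX hh hT
    refine ⟨hbase ▸ hvK, ⟨σ, hσ, hσ0.trans hbase, hσu⟩,
      𝒰, U, R, R', h𝒰, hdom, hbase ▸ hv𝒰, hU, hqU, hR, hback, hR', hRR', fun q hq q' hq' => ?_⟩
    obtain ⟨σ, h1, h2, h3, h4⟩ := hΓ.exists_join hh hdom hR hq hq'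
    exact ⟨σ, h1, h2, h3, (hRR' ⟨hq, hq'⟩).trans h4⟩
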